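/- All graphs are finite and simple. For a graph $H$ with $N\ge 1$ vertices let $L(H)=D(H)-A(H)$ be its Laplacian matrix and write $\det(\lambda I-L(H))=\lambda P(\lambda,H)$, $P(\lambda,H)=\sum_{s=0}^{N-1}(-1)^s c_s(H)\lambda^{N-1-s}$. Call two graphs $H,F$ *$Cmp$-cospectral* if both are forests and there is a bijection between the components of $H$ and those of $F$ that preserves the number of vertices. For graphs $H,F$ with the same number $N$ of vertices and the same number $M$ of edges, write $H\succ\succ^c F$ if $c_s(H)>c_s(F)$ for every $s\in\{2,\dots,M-1\}$ in case $H$ and $F$ are $Cmp$-cospectral, and $c_s(H)>c_s(F)$ for every $s\in\{2,\dots,N-1\}$ otherwise. **Theorem.** Let $G$ be a $2$-edge-connected graph with $n\ge 2$ vertices and $m$ edges (so $m\ge n\ge 3$), and let $\ddot G$ be the graph with $m$ vertices obtained from $G$ by adding $m-n$ isolated vertices. If $G$ is not a cycle, then $O^m\succ\succ^c\ddot G$, where $O^m$ is the cycle with $m$ edges (and $m$ vertices). -/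

import Mathlib

namespace LaplacianOrder

universe u v

/-- `G` has exactly `n` vertices and `m` edges. (A `SimpleGraph` has no loops and no parallel
edges.) -/
def HasSize {V : Type u} [Fintype V] (G : SimpleGraph V) (n m : ℕ) : Prop :=
  Fintype.card V = n ∧ G.edgeSet.ncard = m

open scoped Classical in
/-- The Laplacian polynomial `P(λ, G)`: the quotient of the characteristic polynomial
`det (λ I - L(G))` of the Laplacian matrix `L(G) = D(G) - A(G)` by `λ`. The constant term of
`det (λ I - L(G))` vanishes as soon as `G` has a vertex, so that `λ * P(λ, G) = det (λ I - L(G))`,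
and `divX` is this exact division by `λ`. -/
noncomputable def laplacianPoly {V : Type u} [Fintype V] (G : SimpleGraph V) : Polynomial ℝ :=
  (G.lapMatrix ℝ).charpoly.divX

/-- The coefficient `c_s(G)`, given by `P(λ, G) = ∑_{s = 0}^{n - 1} (-1)^s c_s(G) λ^(n - 1 - s)`,
where `n` is the number of vertices of `G`. It is meant, and used below, for `s ≤ n - 1` only. -/
noncomputable def lapCoeff {V : Type u} [Fintype V] (G : SimpleGraph V) (s : ℕ) : ℝ :=
  (-1) ^ s * (laplacianPoly G).coeff (Fintype.card V - 1 - s)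

/-- `G` and `F` are `Cmp`-cospectral: both are forests, and there is a bijection between their
components that preserves the number of vertices. -/
def CmpCospectral {V : Type u} {W : Type v} (G : SimpleGraph V) (F : SimpleGraph W) : Prop :=
  G.IsAcyclic ∧ F.IsAcyclic ∧
    ∃ σ : G.ConnectedComponent ≃ F.ConnectedComponent,
      ∀ C : G.ConnectedComponent, C.supp.ncard = (σ C).supp.ncard

/-- The relation `G ≻≻^c F` for two graphs with the same number `n` of vertices and the same number
`m` of edges: `c_s(G) > c_s(F)` for all `s ∈ {2, …, m - 1}` if `G` and `F` are `Cmp`-cospectral, and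
`c_s(G) > c_s(F)` for all `s ∈ {2, …, n - 1}` if they are not. -/
def StrictlyDominates {V : Type u} {W : Type v} [Fintype V] [Fintype W]
    (G : SimpleGraph V) (F : SimpleGraph W) : Prop :=
  ∃ n m : ℕ, HasSize G n m ∧ HasSize F n m ∧
    (CmpCospectral G F → ∀ s : ℕ, 2 ≤ s → s < m → lapCoeff F s < lapCoeff G s) ∧
    (¬ CmpCospectral G F → ∀ s : ℕ, 2 ≤ s → s < n → lapCoeff F s < lapCoeff G s)

/-- `G` is `2`-edge-connected: it has at least two vertices, and it stays connected after the
deletion of any set of fewer than two edges. -/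
def TwoEdgeConnected {V : Type u} (G : SimpleGraph V) : Prop :=
  Nontrivial V ∧ G.IsEdgeConnected 2

/-- `G` is a cycle: it is isomorphic to the cycle with `k` vertices for some `k ≥ 3`. -/
def IsCycleGraph {V : Type u} (G : SimpleGraph V) : Prop :=
  ∃ k : ℕ, 3 ≤ k ∧ Nonempty (G ≃g SimpleGraph.cycleGraph k)

/-- The graph obtained from `G` by adding `k` isolated vertices. -/
def addIsolated {V : Type u} (G : SimpleGraph V) (k : ℕ) : SimpleGraph (V ⊕ Fin k) :=
  G.sum (⊥ : SimpleGraph (Fin k))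

end LaplacianOrder

/-! Substituting `-X` for `X` makes `c_s` the coefficient of `X ^ (N - s)` in `det (X + L)`, so
determinants of this form are compared coefficientwise.

A bridgeless connected graph that is not a cycle has `m > n`, so the padded graph has an isolated
vertex `z`. Delete one edge `ru` of `G`: the other `M = m - 1` edges still form a connected graph.
Putting `ru` back gives the determinant `f + g_r + g_u - 2c`, with `f` the determinant before,
`g_r`, `g_u` its minors at `r`, `u`, and `c ≥ 0` an adjugate entry. The cycle arises likewise from
the path with `M` edges; there `c = 1` and the value is `P + 2Q - 2`. The constant `2` only affects
degree `0`, so it suffices that `g_r, g_u ≤ Q` and that `f ≤ P` with strict inequality in degrees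
`1, …, M - 1`.

The bounds hold for every connected graph, by induction on its edges
(`pathBounds_of_edgesReachable`): a bridge gives a product formula that paths share
(`PathBounds.insert_bridge`), any other edge only loses against the path
(`PathBounds.insert_cycle_edge`). For strictness the induction carries an alternative: either lower
bounds that trees satisfy, or a gap `X (1 + X) ^ (M - 2)` between `f` and `P`. The isolated vertex
excludes the former. The signs come from `det_mem_of_rowSum_mem` and `adjugate_mem_of_rowSum_mem`.
-/

namespace Matrix

/-! ### Determinants and adjugates of matrices with nonpositive off-diagonal entries and nonnegative
row sums. -/

variable {V R : Type*} [Fintype V] [DecidableEq V] [CommRing R]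

/-- The matrix whose row `i` is `eᵢ` if `φ i = i` and `eᵢ - e_{φ i}` otherwise. -/
def stepMat (R : Type*) [CommRing R] (φ : V → V) : Matrix V V R :=
  fun i => if φ i = i then Pi.single i 1 else Pi.single i 1 - Pi.single (φ i) 1

omit [Fintype V] in
lemma stepMat_update (φ : V → V) (k : V) :
    stepMat R (Function.update φ k k) = (stepMat R φ).updateRow k (Pi.single k 1) := by
  ext i j
  by_cases hik : i = k
  · subst hik; simp [stepMat]
  · simp [stepMat, hik]

lemma card_nonfixed_update_lt (φ : V → V) (k : V) (hk : φ k ≠ k) :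
    (Finset.univ.filter fun i => Function.update φ k k i ≠ i).card <
      (Finset.univ.filter fun i => φ i ≠ i).card := by
  apply Finset.card_lt_card
  rw [Finset.ssubset_iff_of_subset]
  · exact ⟨k, by simp [hk], by simp⟩
  · intro i
    by_cases hik : i = k
    · subst hik; simp
    · simp [hik]

/-- The determinant is `1` if every orbit of `φ` ends in a fixed point, and `0` if `φ` has a longer
cycle. -/
lemma det_stepMat_mem [IsDomain R] (S : Subsemiring R) (φ : V → V) : (stepMat R φ).det ∈ S := by
  induction hn : (Finset.univ.filter fun i => φ i ≠ i).card using Nat.strong_induction_on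
    generalizing φ with
  | _ n ih =>
  -- If `φ k` is fixed, adding row `φ k` to row `k` turns the latter into `e_k`: the point `k`
  -- becomes fixed and the determinant does not change.
  by_cases h : ∃ k, φ k ≠ k ∧ φ (φ k) = φ k
  · obtain ⟨k, hk, hfix⟩ := h
    have h1 := ih _ (hn ▸ card_nonfixed_update_lt φ k hk) _ rfl
    rw [stepMat_update] at h1
    convert h1 using 1
    rw [← det_updateRow_add_self (stepMat R φ) (Ne.symm hk)]
    congr 2
    simp [stepMat, hk, hfix]
  push Not at h
  by_cases hU : ∀ i, φ i = i
  · have : stepMat R φ = 1 := by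
      ext i j
      simp [stepMat, hU, Matrix.one_apply, Pi.single_apply, eq_comm]
    simp [this]
  push Not at hU
  obtain ⟨k, hk⟩ := hU
  -- Now `φ` maps non-fixed points to non-fixed points, so their indicator lies in the kernel.
  have : (stepMat R φ).det = 0 := by
    rw [← exists_mulVec_eq_zero_iff]
    refine ⟨fun i => if φ i = i then 0 else 1, fun h0 => ?_, ?_⟩
    · simpa [hk] using congrFun h0 k
    · ext i
      by_cases hi : φ i = i
      · simp [mulVec, stepMat, hi]
      · simp only [mulVec, stepMat, hi, if_false, Pi.zero_apply]
        rw [sub_dotProduct]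
        simp [hi, h i hi]
  rw [this]; exact S.zero_mem

/-- The determinant of `A` with rows `r` and `u` replaced by `x` and `y`. -/
def detUpdateTwo (A : Matrix V V R) (r u : V) (x y : V → R) : R :=
  ((A.updateRow r x).updateRow u y).det

section detUpdateTwo

variable (A : Matrix V V R) {r u : V} (x x' y y' : V → R)

lemma detUpdateTwo_comm (h : r ≠ u) : A.detUpdateTwo r u x y = A.detUpdateTwo u r y x := by
  unfold detUpdateTwo
  congr 1
  ext i j
  by_cases h1 : i = r
  · subst h1; simp [h]
  · simp [updateRow_apply, h1]

lemma detUpdateTwo_self (h : r ≠ u) : A.detUpdateTwo r u x x = 0 :=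
  det_zero_of_row_eq h (by ext j; simp [updateRow_apply, h])

lemma detUpdateTwo_add_right :
    A.detUpdateTwo r u x (y + y') = A.detUpdateTwo r u x y + A.detUpdateTwo r u x y' :=
  det_updateRow_add _ _ _ _

lemma detUpdateTwo_sub_right :
    A.detUpdateTwo r u x (y - y') = A.detUpdateTwo r u x y - A.detUpdateTwo r u x y' := by
  have := detUpdateTwo_add_right A (r := r) (u := u) x (y - y') y'
  rw [sub_add_cancel] at this
  linear_combination -this

lemma detUpdateTwo_sub_left (h : r ≠ u) :
    A.detUpdateTwo r u (x - x') y = A.detUpdateTwo r u x y - A.detUpdateTwo r u x' y := by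
  simp only [detUpdateTwo_comm A _ _ h, detUpdateTwo_sub_right]

lemma detUpdateTwo_swap (h : r ≠ u) : A.detUpdateTwo r u x y = -A.detUpdateTwo r u y x := by
  have h0 := detUpdateTwo_self A (x - y) h
  rw [detUpdateTwo_sub_right, detUpdateTwo_sub_left _ _ _ _ h, detUpdateTwo_sub_left _ _ _ _ h,
    detUpdateTwo_self _ _ h, detUpdateTwo_self _ _ h] at h0
  linear_combination -h0

lemma detUpdateTwo_row_left : A.detUpdateTwo r u (A r) y = (A.updateRow u y).det := by
  simp [detUpdateTwo]

lemma detUpdateTwo_row_right (h : r ≠ u) :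
    A.detUpdateTwo r u x (A u) = (A.updateRow r x).det := by
  rw [detUpdateTwo_comm _ _ _ h, detUpdateTwo_row_left]

lemma detUpdateTwo_row_row (h : r ≠ u) : A.detUpdateTwo r u (A r) (A u) = A.det := by
  rw [detUpdateTwo_row_right _ _ h, updateRow_eq_self]

end detUpdateTwo

/-- Follow the orbit of `r` under `φ`: each step fixes the point just left and moves the target to
its image, until `u` or a fixed point is met. -/
lemma det_stepMat_updateRow_mem [IsDomain R] (S : Subsemiring R) (φ : V → V) (u r : V) :
    ((stepMat R φ).updateRow u (Pi.single r 1)).det ∈ S := by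
  induction hn : (Finset.univ.filter fun i => φ i ≠ i).card using Nat.strong_induction_on
    generalizing φ r with
  | _ n ih =>
  by_cases hr : r = u
  · subst hr
    rw [← stepMat_update]
    exact det_stepMat_mem S _
  by_cases hw : φ r = r
  · rw [det_zero_of_row_eq hr (by ext j; simp [hr, stepMat, hw])]
    exact S.zero_mem
  · have h1 := ih _ (hn ▸ card_nonfixed_update_lt φ r hw) (Function.update φ r r) (φ r) rfl
    convert h1 using 1
    -- With `e_r` in row `u`, row `r` may be replaced by `-e_{φ r}`; swapping the two rows absorbs
    -- the sign.
    have hrow : stepMat R φ r = Pi.single r 1 - Pi.single (φ r) 1 := by simp [stepMat, hw]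
    rw [stepMat_update, ← detUpdateTwo_row_left (r := r), hrow,
      detUpdateTwo_sub_left _ _ _ _ hr, detUpdateTwo_self _ _ hr, detUpdateTwo_swap _ _ _ hr]
    simp [detUpdateTwo]

lemma det_sum_smul_mem (S : Subsemiring R) (w : V → V → R) (ρ : V → V → V → R)
    (hw : ∀ i j, w i j ∈ S) (hρ : ∀ φ : V → V, det (fun i => ρ i (φ i)) ∈ S) :
    det (fun i => ∑ j, w i j • ρ i j) ∈ S := by
  have h1 : det (fun i => ∑ j, w i j • ρ i j) =
      ∑ φ : V → V, det (fun i => w i (φ i) • ρ i (φ i)) :=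
    (detRowAlternating (n := V) (R := R)).toMultilinearMap.map_sum (fun i j => w i j • ρ i j)
  rw [h1]
  refine S.sum_mem fun φ _ => ?_
  have h2 : det (fun i => w i (φ i) • ρ i (φ i)) = (∏ i, w i (φ i)) • det (fun i => ρ i (φ i)) :=
    (detRowAlternating (n := V) (R := R)).toMultilinearMap.map_smul_univ _ _
  rw [h2]
  exact S.mul_mem (S.prod_mem fun i _ => hw i _) (hρ φ)

lemma row_eq_sum_smul_step (M : Matrix V V R) (i : V) :
    M i = ∑ j, (if j = i then ∑ k, M i k else -M i j) • stepMat R (fun _ => j) i := by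
  rw [← Finset.add_sum_erase _ _ (Finset.mem_univ i)]
  have h1 : ∀ j ∈ Finset.univ.erase i,
      (if j = i then ∑ k, M i k else -M i j) • stepMat R (fun _ => j) i =
        M i j • Pi.single j 1 - M i j • Pi.single i 1 := by
    intro j hj
    have hj : j ≠ i := Finset.ne_of_mem_erase hj
    simp only [stepMat, hj, if_false]
    module
  rw [Finset.sum_congr rfl h1, Finset.sum_sub_distrib, ← Finset.sum_smul,
    ← Finset.add_sum_erase Finset.univ (M i) (Finset.mem_univ i)]
  have h2 : M i = M i i • Pi.single i 1 + ∑ j ∈ Finset.univ.erase i, M i j • Pi.single j 1 := by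
    rw [Finset.add_sum_erase Finset.univ (fun j => M i j • (Pi.single j 1 : V → R))
      (Finset.mem_univ i)]
    ext j
    simp [Finset.sum_apply, Pi.single_apply]
  conv_lhs => rw [h2]
  simp only [stepMat, if_true, add_smul]
  abel

/-- The determinant of a matrix with nonpositive off-diagonal entries and nonnegative row sums is
nonnegative, where the nonnegative elements are those of a subsemiring. -/
theorem det_mem_of_rowSum_mem [IsDomain R] (S : Subsemiring R) {M : Matrix V V R}
    (off : ∀ i j, i ≠ j → -M i j ∈ S) (row : ∀ i, ∑ j, M i j ∈ S) : M.det ∈ S := by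
  have key : M = fun i => ∑ j, (if j = i then ∑ k, M i k else -M i j) •
      stepMat R (fun _ => j) i := funext fun i => row_eq_sum_smul_step M i
  rw [key]
  refine det_sum_smul_mem S _ _ (fun i j => ?_) fun φ => det_stepMat_mem S φ
  split_ifs with h
  · exact row i
  · exact off i j (Ne.symm h)

/-- The adjugate of a matrix with nonpositive off-diagonal entries and nonnegative row sums is
nonnegative, where the nonnegative elements are those of a subsemiring. -/
theorem adjugate_mem_of_rowSum_mem [IsDomain R] (S : Subsemiring R) {M : Matrix V V R}
    (off : ∀ i j, i ≠ j → -M i j ∈ S) (row : ∀ i, ∑ j, M i j ∈ S) (r u : V) :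
    M.adjugate r u ∈ S := by
  have key : M.updateRow u (Pi.single r 1) = fun i => ∑ j,
      -- Row `u` is the single vector `e_r`; its whole weight is put on the index `u`.
      (if i = u then (if j = u then 1 else 0) else if j = i then ∑ k, M i k else -M i j) •
      (if i = u then Pi.single r 1 else stepMat R (fun _ => j) i) := by
    funext i
    by_cases hi : i = u
    · subst hi
      simp only [updateRow_self, if_true, ite_smul, one_smul, zero_smul, Finset.sum_ite_eq',
        Finset.mem_univ]
    · simp only [hi, if_false]
      rw [← row_eq_sum_smul_step M i]
      ext k
      simp [hi]
  rw [adjugate_apply, key]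
  refine det_sum_smul_mem S _ _ (fun i j => ?_) fun φ => ?_
  · split_ifs with h1 h2 h3
    · exact S.one_mem
    · exact S.zero_mem
    · exact row i
    · exact off i j (Ne.symm h3)
  · convert det_stepMat_updateRow_mem S φ u r using 1
    congr 1
    ext i k
    by_cases hi : i = u
    · subst hi; simp
    · simp [hi, stepMat]

/-! ### Adding the Laplacian of an edge. -/

lemma det_add_vecMulVec_edge (A : Matrix V V R) {r u : V} (h : r ≠ u) :
    (A + vecMulVec (Pi.single r 1 - Pi.single u 1) (Pi.single r 1 - Pi.single u 1)).det =
      A.det + A.adjugate r r + A.adjugate u u - A.adjugate r u - A.adjugate u r := by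
  have hA : A + vecMulVec (Pi.single r 1 - Pi.single u 1) (Pi.single r 1 - Pi.single u 1) =
      (A.updateRow r (A r + (Pi.single r 1 - Pi.single u 1))).updateRow u
        (A u - (Pi.single r 1 - Pi.single u 1)) := by
    ext i j
    by_cases hu : i = u
    · subst hu; simp [vecMulVec_apply, h.symm]; ring
    by_cases hr : i = r
    · subst hr; simp [vecMulVec_apply, h]
    · simp [vecMulVec_apply, hu, hr]
  have hsub : A r + (Pi.single r 1 - Pi.single u 1) = A r - (Pi.single u 1 - Pi.single r 1) := by
    abel
  rw [hA, ← detUpdateTwo, hsub]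
  simp only [detUpdateTwo_sub_right, detUpdateTwo_sub_left _ _ _ _ h, detUpdateTwo_row_row _ h]
  simp only [detUpdateTwo_row_left, detUpdateTwo_row_right _ _ h, detUpdateTwo_self _ _ h, adjugate_apply,
    detUpdateTwo_swap A (Pi.single u 1) (Pi.single r 1) h]
  ring

lemma adjugate_add_vecMulVec_edge (A : Matrix V V R) {r u : V} (h : r ≠ u) :
    (A + vecMulVec (Pi.single r 1 - Pi.single u 1)
        (Pi.single r 1 - Pi.single u 1)).adjugate r r =
      A.adjugate r r + A.detUpdateTwo r u (Pi.single r 1) (Pi.single u 1) := by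
  have hA : (A + vecMulVec (Pi.single r 1 - Pi.single u 1)
        (Pi.single r 1 - Pi.single u 1)).updateRow r (Pi.single r 1) =
      (A.updateRow r (Pi.single r 1)).updateRow u (A u - (Pi.single r 1 - Pi.single u 1)) := by
    ext i j
    by_cases hu : i = u
    · subst hu; simp [vecMulVec_apply, h.symm]; ring
    by_cases hr : i = r
    · subst hr; simp [h]
    · simp [vecMulVec_apply, hu, hr]
  rw [adjugate_apply, hA, ← detUpdateTwo]
  simp only [detUpdateTwo_sub_right, detUpdateTwo_row_right _ _ h, detUpdateTwo_self _ _ h,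
    adjugate_apply]
  ring

lemma mul_adjugate_of_mulVec_single {A : Matrix V V R} {z : V} {x : R}
    (h : A *ᵥ Pi.single z 1 = x • Pi.single z 1) (i : V) :
    x * A.adjugate i z = if i = z then A.det else 0 := by
  have h1 := congrArg (A.adjugate *ᵥ ·) h
  simp only [mulVec_mulVec, adjugate_mul, mulVec_smul] at h1
  have h2 := congrFun h1 i
  simpa [smul_mulVec, Pi.single_apply, Matrix.one_apply] using h2.symm

end Matrix

open Polynomial Matrix

/-! ### The coefficientwise order and the path polynomials. -/

/-- The subsemiring of real polynomials with nonnegative coefficients. -/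
def coeffNonneg : Subsemiring ℝ[X] where
  carrier := {p | ∀ k, 0 ≤ p.coeff k}
  mul_mem' {p q} hp hq k := by
    rw [coeff_mul]
    exact Finset.sum_nonneg fun x _ => mul_nonneg (hp _) (hq _)
  one_mem' k := by rw [coeff_one]; split_ifs <;> norm_num
  add_mem' {p q} hp hq k := by rw [coeff_add]; exact add_nonneg (hp k) (hq k)
  zero_mem' k := by simp

lemma X_mem_coeffNonneg : (X : ℝ[X]) ∈ coeffNonneg := fun k => by
  rw [coeff_X]; split_ifs <;> norm_num

lemma one_add_X_pow_mem_coeffNonneg (k : ℕ) : ((1 + X) ^ k : ℝ[X]) ∈ coeffNonneg :=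
  pow_mem (add_mem (one_mem _) X_mem_coeffNonneg) k

lemma X_pow_mul_mem_coeffNonneg {p : ℝ[X]} (k : ℕ) : X ^ k * p ∈ coeffNonneg ↔ p ∈ coeffNonneg := by
  refine ⟨fun h j => ?_, fun h => mul_mem (pow_mem X_mem_coeffNonneg k) h⟩
  have := h (j + k)
  rwa [coeff_X_pow_mul] at this

/-- The pair `(G, E)` of polynomials attached to the path with `k` edges: `G` is the principal minor
of `X + L` belonging to an end of the path, and `X * E` the determinant of `X + L` for the path with
one edge less. -/
noncomputable def pathPair : ℕ → ℝ[X] × ℝ[X]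
  | 0 => (1, 0)
  | k + 1 => (X * ((pathPair k).2 + (pathPair k).1) + (pathPair k).1,
      (pathPair k).2 + (pathPair k).1)

/-- The end minor of `X + L` for the path with `k` edges. -/
noncomputable def pathMinor (k : ℕ) : ℝ[X] := (pathPair k).1

/-- The off-end sequence associated with `pathMinor`. -/
noncomputable def pathAux (k : ℕ) : ℝ[X] := (pathPair k).2

/-- The determinant of `X + L` for the path with `k` edges. -/
noncomputable def pathDet (k : ℕ) : ℝ[X] := X * pathAux (k + 1)

lemma pathMinor_zero : pathMinor 0 = 1 := rfl

lemma pathAux_zero : pathAux 0 = 0 := rfl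

lemma pathAux_succ (k : ℕ) : pathAux (k + 1) = pathAux k + pathMinor k := rfl

lemma pathMinor_succ (k : ℕ) : pathMinor (k + 1) = X * pathAux (k + 1) + pathMinor k := rfl

lemma pathDet_zero : pathDet 0 = X := by
  simp [pathDet, pathAux_succ, pathAux_zero, pathMinor_zero]

lemma pathMinor_succ' (k : ℕ) : pathMinor (k + 1) = pathDet k + pathMinor k := rfl

lemma pathDet_succ (k : ℕ) :
    pathDet (k + 1) = pathDet k + X * pathDet k + X * pathMinor k := by
  rw [pathDet, pathAux_succ, pathMinor_succ', pathDet]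
  ring

/-- The two addition formulas need each other in the induction. -/
lemma pathMinor_add_and_pathAux_add (a c : ℕ) :
    pathMinor (a + c) = pathMinor a * pathMinor c + X * pathAux a * pathAux c ∧
    pathAux (a + c + 1) = pathAux (a + 1) * pathMinor c + pathMinor a * pathAux c := by
  induction a with
  | zero =>
    rw [zero_add]
    simp [pathAux_succ, pathAux_zero, pathMinor_zero, add_comm]
  | succ a ih =>
    obtain ⟨h1, h2⟩ := ih
    have h3 : pathMinor (a + 1 + c) =
        pathMinor (a + 1) * pathMinor c + X * pathAux (a + 1) * pathAux c := by
      rw [show a + 1 + c = a + c + 1 by ring, pathMinor_succ, h1, h2, pathMinor_succ, pathAux_succ]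
      ring
    refine ⟨h3, ?_⟩
    rw [pathAux_succ (a + 1 + c), h3, show a + 1 + c = a + c + 1 by ring, h2,
      pathAux_succ (a + 1), pathMinor_succ a]
    ring

lemma pathDet_add_add_one (a b : ℕ) :
    pathDet (a + b + 1) =
      pathDet a * pathDet b + pathDet a * pathMinor b + pathMinor a * pathDet b := by
  have := (pathMinor_add_and_pathAux_add a (b + 1)).2
  rw [pathDet, show a + b + 1 + 1 = a + (b + 1) + 1 by ring, this, pathMinor_succ', pathDet, pathDet]
  ring

lemma pathMinor_pathAux_mem (k : ℕ) : pathMinor k ∈ coeffNonneg ∧ pathAux k ∈ coeffNonneg := by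
  induction k with
  | zero => exact ⟨one_mem _, zero_mem _⟩
  | succ k ih =>
    have := add_mem ih.2 ih.1
    exact ⟨add_mem (mul_mem X_mem_coeffNonneg this) ih.1, this⟩

lemma pathMinor_mem (k : ℕ) : pathMinor k ∈ coeffNonneg := (pathMinor_pathAux_mem k).1

lemma pathDet_mem (k : ℕ) : pathDet k ∈ coeffNonneg :=
  mul_mem X_mem_coeffNonneg (pathMinor_pathAux_mem _).2

/-- By the addition formula the difference is `X * pathAux a * pathAux (b + 1)`. -/
lemma pathMinor_add_add_one (a b : ℕ) :
    pathMinor (a + b + 1) - pathMinor a * (pathDet b + pathMinor b) ∈ coeffNonneg := by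
  rw [show a + b + 1 = a + (b + 1) by ring, (pathMinor_add_and_pathAux_add a (b + 1)).1,
    ← pathMinor_succ', add_sub_cancel_left]
  exact mul_mem (mul_mem X_mem_coeffNonneg (pathMinor_pathAux_mem _).2) (pathMinor_pathAux_mem _).2

/-- Combinatorially, `(1 + X) ^ k` sums over the sets of deleted edges, choosing only one of the
possible rootings of each remaining forest. -/
lemma pathMinor_pathDet_lower (k : ℕ) :
    pathMinor k - (1 + X) ^ k ∈ coeffNonneg ∧ pathDet k - X * (1 + X) ^ k ∈ coeffNonneg := by
  induction k with
  | zero => simp [pathDet_zero, pathMinor_zero, zero_mem]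
  | succ k ih =>
    constructor
    · rw [pathMinor_succ']
      convert add_mem ih.1 ih.2 using 1
      ring
    · rw [pathDet_succ]
      convert add_mem (add_mem ih.2 (mul_mem X_mem_coeffNonneg ih.2))
        (mul_mem X_mem_coeffNonneg (pathMinor_mem k)) using 1
      ring

/-! ### The matrix `X + L` of an edge set on a fixed vertex set. -/

section Pencil

variable {V : Type*} [Fintype V] [DecidableEq V]

/-- The Laplacian matrix of a single edge. -/
noncomputable def edgeLap (e : Sym2 V) : Matrix V V ℝ[X] :=
  Sym2.lift ⟨fun a b => vecMulVec (Pi.single a 1 - Pi.single b 1) (Pi.single a 1 - Pi.single b 1),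
    fun a b => by ext1 i j; simp only [vecMulVec_apply, Pi.sub_apply]; ring⟩ e

omit [Fintype V] in
lemma edgeLap_mk (a b : V) : edgeLap s(a, b) =
    vecMulVec (Pi.single a 1 - Pi.single b 1) (Pi.single a 1 - Pi.single b 1) := rfl

/-- The matrix `X + L` of the graph with edge set `E`. -/
noncomputable def lapPencil (E : Finset (Sym2 V)) : Matrix V V ℝ[X] :=
  (X : ℝ[X]) • 1 + ∑ e ∈ E, edgeLap e

omit [Fintype V] in
lemma lapPencil_insert {E : Finset (Sym2 V)} {e : Sym2 V} (h : e ∉ E) :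
    lapPencil (insert e E) = lapPencil E + edgeLap e := by
  rw [lapPencil, lapPencil, Finset.sum_insert h]
  abel

lemma edgeLap_mulVec_single {e : Sym2 V} {z : V} (h : z ∉ e) :
    edgeLap e *ᵥ Pi.single z 1 = 0 := by
  induction e with
  | h a b =>
  simp only [Sym2.mem_iff, not_or] at h
  ext i
  simp [edgeLap_mk, vecMulVec_apply, h.1, h.2]

omit [Fintype V] in
lemma edgeLap_isSymm (e : Sym2 V) : (edgeLap e).IsSymm := by
  induction e with
  | h a b => exact transpose_vecMulVec _ _

omit [Fintype V] in
lemma lapPencil_isSymm (E : Finset (Sym2 V)) : (lapPencil E).IsSymm := by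
  rw [IsSymm, lapPencil, transpose_add, transpose_smul, transpose_one, transpose_sum]
  congr 1
  exact Finset.sum_congr rfl fun e _ => edgeLap_isSymm e

lemma lapPencil_mulVec_single {E : Finset (Sym2 V)} {z : V} (h : ∀ e ∈ E, z ∉ e) :
    lapPencil E *ᵥ Pi.single z 1 = (X : ℝ[X]) • Pi.single z 1 := by
  rw [lapPencil, add_mulVec, sum_mulVec, Finset.sum_eq_zero fun e he => edgeLap_mulVec_single (h e he),
    add_zero, smul_mulVec, one_mulVec]

lemma single_vecMul_lapPencil {E : Finset (Sym2 V)} {z : V} (h : ∀ e ∈ E, z ∉ e) :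
    Pi.single z 1 ᵥ* lapPencil E = (X : ℝ[X]) • Pi.single z 1 := by
  rw [← mulVec_transpose, lapPencil_isSymm, lapPencil_mulVec_single h]

lemma lapPencil_col {E : Finset (Sym2 V)} {z : V} (h : ∀ e ∈ E, z ∉ e) (i : V) :
    lapPencil E i z = if i = z then X else 0 := by
  simpa [Pi.single_apply] using congrFun (lapPencil_mulVec_single h) i

lemma edgeLap_mul_edgeLap {e e' : Sym2 V} (h : ∀ v ∈ e, v ∉ e') : edgeLap e * edgeLap e' = 0 := by
  induction e with
  | h a b =>
  induction e' with
  | h c d =>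
  simp only [Sym2.mem_iff, not_or, forall_eq_or_imp, forall_eq] at h
  rw [edgeLap_mk, edgeLap_mk, vecMulVec_mul_vecMulVec]
  have : (Pi.single a 1 - Pi.single b 1 : V → ℝ[X]) ⬝ᵥ (Pi.single c 1 - Pi.single d 1) = 0 := by
    simp [h.1.1, h.1.2, h.2.1, h.2.2]
  ext i j
  simp [this]

/-- Laplacians of vertex-disjoint edge sets annihilate each other. This product replaces a block
decomposition and is the source of the factors `X ^ Fintype.card V` below. -/
lemma lapPencil_mul_lapPencil {E E' : Finset (Sym2 V)} (h : ∀ e ∈ E, ∀ e' ∈ E', ∀ v ∈ e, v ∉ e') :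
    lapPencil E * lapPencil E' = (X : ℝ[X]) • lapPencil (E ∪ E') := by
  have hd : Disjoint E E' := Finset.disjoint_left.2 fun e he he' => by
    induction e with
    | h a b => exact h _ he _ he' a (Sym2.mem_mk_left a b) (Sym2.mem_mk_left a b)
  have h0 : (∑ e ∈ E, edgeLap e) * (∑ e ∈ E', edgeLap e) = 0 := by
    rw [Finset.sum_mul_sum]
    exact Finset.sum_eq_zero fun e he => Finset.sum_eq_zero fun e' he' =>
      edgeLap_mul_edgeLap (h e he e' he')
  rw [lapPencil, lapPencil, lapPencil, Finset.sum_union hd, add_mul, mul_add, mul_add, h0]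
  simp only [smul_mul_assoc, one_mul, mul_smul_comm, mul_one, smul_add, add_zero]
  abel

omit [Fintype V] in
lemma neg_edgeLap_apply_mem (e : Sym2 V) {i j : V} (h : i ≠ j) : -edgeLap e i j ∈ coeffNonneg := by
  induction e with
  | h a b =>
  have : -edgeLap s(a, b) i j = (if i = a then 1 else 0) * (if j = b then 1 else 0) +
      (if i = b then 1 else 0) * (if j = a then 1 else 0) := by
    simp only [edgeLap_mk, vecMulVec_apply, Pi.sub_apply, Pi.single_apply]
    split_ifs <;> simp_all
  rw [this]
  refine add_mem (mul_mem ?_ ?_) (mul_mem ?_ ?_) <;> split_ifs <;>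
    first | exact one_mem _ | exact zero_mem _

omit [Fintype V] in
lemma neg_lapPencil_apply_mem (E : Finset (Sym2 V)) {i j : V} (h : i ≠ j) :
    -lapPencil E i j ∈ coeffNonneg := by
  rw [lapPencil, Matrix.add_apply, Matrix.smul_apply, one_apply_ne h, Matrix.sum_apply, smul_zero,
    zero_add, ← Finset.sum_neg_distrib]
  exact sum_mem fun e _ => neg_edgeLap_apply_mem e h

lemma edgeLap_mulVec_one (e : Sym2 V) : edgeLap e *ᵥ 1 = 0 := by
  induction e with
  | h a b =>
  rw [edgeLap_mk, vecMulVec_mulVec]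
  simp

lemma lapPencil_mulVec_one (E : Finset (Sym2 V)) : lapPencil E *ᵥ 1 = (X : ℝ[X]) • 1 := by
  rw [lapPencil, add_mulVec, sum_mulVec, Finset.sum_eq_zero fun e _ => edgeLap_mulVec_one e,
    add_zero, smul_mulVec, one_mulVec]

lemma lapPencil_rowSum (E : Finset (Sym2 V)) (i : V) : ∑ j, lapPencil E i j = X := by
  simpa [mulVec, dotProduct] using congrFun (lapPencil_mulVec_one E) i

/-- The determinant of `X + L`. -/
noncomputable def lapDet (E : Finset (Sym2 V)) : ℝ[X] := (lapPencil E).det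

/-- The principal minor of `X + L` belonging to `r`. -/
noncomputable def lapMinor (E : Finset (Sym2 V)) (r : V) : ℝ[X] := (lapPencil E).adjugate r r

lemma adjugate_lapPencil_mem (E : Finset (Sym2 V)) (r u : V) :
    (lapPencil E).adjugate r u ∈ coeffNonneg :=
  adjugate_mem_of_rowSum_mem _ (fun _ _ => neg_lapPencil_apply_mem E)
    (fun i => by rw [lapPencil_rowSum]; exact X_mem_coeffNonneg) r u

lemma lapMinor_mem (E : Finset (Sym2 V)) (r : V) : lapMinor E r ∈ coeffNonneg :=
  adjugate_lapPencil_mem E r r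

lemma lapDet_mem (E : Finset (Sym2 V)) : lapDet E ∈ coeffNonneg :=
  det_mem_of_rowSum_mem _ (fun _ _ => neg_lapPencil_apply_mem E)
    (fun i => by rw [lapPencil_rowSum]; exact X_mem_coeffNonneg)

lemma adjugate_lapPencil_symm (E : Finset (Sym2 V)) (r u : V) :
    (lapPencil E).adjugate r u = (lapPencil E).adjugate u r := by
  have := adjugate_transpose (lapPencil E)
  rw [lapPencil_isSymm] at this
  exact congrFun (congrFun this u) r

/-- The all-ones vector is an eigenvector of `X + L` with eigenvalue `X`; apply the adjugate to it.
-/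
lemma lapDet_eq_sum (E : Finset (Sym2 V)) (r : V) :
    lapDet E = X * ∑ w, (lapPencil E).adjugate r w := by
  have h1 := congrArg ((lapPencil E).adjugate *ᵥ ·) (lapPencil_mulVec_one E)
  simp only [mulVec_mulVec, adjugate_mul, mulVec_smul, smul_mulVec, one_mulVec] at h1
  simpa [mulVec, dotProduct, lapDet] using congrFun h1 r

lemma lapDet_sub_X_mul_lapMinor_mem (E : Finset (Sym2 V)) (r : V) :
    lapDet E - X * lapMinor E r ∈ coeffNonneg := by
  rw [lapDet_eq_sum E r, ← Finset.add_sum_erase _ _ (Finset.mem_univ r), mul_add, lapMinor,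
    add_sub_cancel_left]
  exact mul_mem X_mem_coeffNonneg (sum_mem fun w _ => adjugate_lapPencil_mem E r w)

/-- The principal minor of `X + L` belonging to `r` and `u`. -/
noncomputable def lapMinorTwo (E : Finset (Sym2 V)) (r u : V) : ℝ[X] :=
  (lapPencil E).detUpdateTwo r u (Pi.single r 1) (Pi.single u 1)

lemma lapMinor_sub_X_mul_lapMinorTwo_mem (E : Finset (Sym2 V)) {r u : V} (h : r ≠ u) :
    lapMinor E r - X * lapMinorTwo E r u ∈ coeffNonneg := by
  set A := (lapPencil E).updateRow r (Pi.single r 1) with hA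
  -- The row sums stay nonnegative after row `r` is replaced by `e_r`, so the adjugate of `A` is
  -- still nonnegative.
  have hrow : ∀ i, ∑ j, A i j = if i = r then 1 else X := by
    intro i
    by_cases hi : i = r
    · subst hi; simp [hA]
    · simp [hA, hi, lapPencil_rowSum]
  have hadj : ∀ i j, A.adjugate i j ∈ coeffNonneg := by
    refine adjugate_mem_of_rowSum_mem _ (fun i j hij => ?_) fun i => ?_
    · by_cases hi : i = r
      · subst hi; simp [hA, hij.symm, zero_mem]
      · simpa [hA, hi] using neg_lapPencil_apply_mem E hij
    · rw [hrow]; split_ifs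
      · exact one_mem _
      · exact X_mem_coeffNonneg
  have h1 := congrFun (congrArg (A.adjugate *ᵥ ·) (show A *ᵥ 1 = fun i => if i = r then 1 else X by
    ext1 i; simpa [mulVec, dotProduct] using hrow i)) u
  simp only [mulVec_mulVec, adjugate_mul, smul_mulVec, one_mulVec] at h1
  have h2 : lapMinor E r = A.det := adjugate_apply _ _ _
  have h3 : lapMinorTwo E r u = A.adjugate u u := (adjugate_apply _ _ _).symm
  rw [h2, h3]
  have h4 : A.det = ∑ j, A.adjugate u j * (if j = r then 1 else X) := by
    simpa [mulVec, dotProduct] using h1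
  rw [h4, ← Finset.add_sum_erase _ _ (Finset.mem_univ u), if_neg h.symm, mul_comm,
    add_sub_cancel_left]
  refine sum_mem fun j _ => mul_mem (hadj _ _) ?_
  split_ifs
  · exact one_mem _
  · exact X_mem_coeffNonneg

lemma lapDet_insert {E : Finset (Sym2 V)} {r u : V} (h : s(r, u) ∉ E) (hru : r ≠ u) :
    lapDet (insert s(r, u) E) =
      lapDet E + lapMinor E r + lapMinor E u - 2 * (lapPencil E).adjugate r u := by
  rw [lapDet, lapPencil_insert h, edgeLap_mk, det_add_vecMulVec_edge _ hru,
    adjugate_lapPencil_symm E u r, lapDet, lapMinor, lapMinor]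
  ring

lemma lapMinor_insert {E : Finset (Sym2 V)} {r u : V} (h : s(r, u) ∉ E) (hru : r ≠ u) :
    lapMinor (insert s(r, u) E) r = lapMinor E r + lapMinorTwo E r u := by
  rw [lapMinor, lapPencil_insert h, edgeLap_mk, adjugate_add_vecMulVec_edge _ hru, lapMinor,
    lapMinorTwo]

/-! ### Joining two vertex-disjoint graphs by an edge. -/

section Bridge

variable {E E' : Finset (Sym2 V)} {r u : V}

lemma lapDet_mul_lapDet (h : ∀ e ∈ E, ∀ e' ∈ E', ∀ v ∈ e, v ∉ e') :
    X ^ Fintype.card V * lapDet (E ∪ E') = lapDet E * lapDet E' := by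
  rw [lapDet, lapDet, lapDet, ← det_mul, lapPencil_mul_lapPencil h, det_smul]

lemma adjugate_lapPencil_union (h : ∀ e ∈ E, ∀ e' ∈ E', ∀ v ∈ e, v ∉ e')
    (hr : ∀ e ∈ E', r ∉ e) (u : V) :
    X ^ Fintype.card V * (lapPencil (E ∪ E')).adjugate r u =
      (lapPencil E).adjugate r u * lapDet E' := by
  rw [adjugate_apply, adjugate_apply, lapDet, ← det_mul, ← det_smul, updateRow_mul,
    lapPencil_mul_lapPencil h, single_vecMul_lapPencil hr]
  congr 1
  ext i j
  by_cases hi : i = u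
  · subst hi; simp
  · simp [hi]

lemma lapMinor_union (h : ∀ e ∈ E, ∀ e' ∈ E', ∀ v ∈ e, v ∉ e') (hr : ∀ e ∈ E', r ∉ e) :
    X ^ Fintype.card V * lapMinor (E ∪ E') r = lapMinor E r * lapDet E' :=
  adjugate_lapPencil_union h hr r

/-- As `u` is isolated in `E`, the vector `e_u` is an eigenvector there and the adjugate of `E`
already vanishes at `(r, u)`. -/
lemma adjugate_lapPencil_union_eq_zero (h : ∀ e ∈ E, ∀ e' ∈ E', ∀ v ∈ e, v ∉ e')
    (hr : ∀ e ∈ E', r ∉ e) (hu : ∀ e ∈ E, u ∉ e) (hru : r ≠ u) :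
    (lapPencil (E ∪ E')).adjugate r u = 0 := by
  have h1 := adjugate_lapPencil_union h hr u
  have h2 := mul_adjugate_of_mulVec_single (lapPencil_mulVec_single hu) r
  rw [if_neg hru] at h2
  rw [(mul_eq_zero.1 h2).resolve_left X_ne_zero, zero_mul] at h1
  exact (mul_eq_zero.1 h1).resolve_left (pow_ne_zero _ X_ne_zero)

lemma lapMinorTwo_union (h : ∀ e ∈ E, ∀ e' ∈ E', ∀ v ∈ e, v ∉ e')
    (hr : ∀ e ∈ E', r ∉ e) (hu : ∀ e ∈ E, u ∉ e) (hru : r ≠ u) :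
    X ^ Fintype.card V * lapMinorTwo (E ∪ E') r u = lapMinor E r * lapMinor E' u := by
  rw [lapMinorTwo, detUpdateTwo, lapMinor, lapMinor, adjugate_apply, adjugate_apply, mul_comm,
    mul_comm ((lapPencil E).updateRow _ _).det, ← det_mul, mul_comm, ← det_smul]
  congr 1
  have h' : ∀ e' ∈ E', ∀ e ∈ E, ∀ v ∈ e', v ∉ e := fun e' he' e he v hv' hv => h e he e' he' v hv hv'
  -- Row and column `r` of `lapPencil E'` are `X` times unit vectors, so replacing row `r` commutes
  -- with the product formula.
  have h1 : lapPencil E' * (lapPencil E).updateRow r (Pi.single r 1) =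
      (X : ℝ[X]) • (lapPencil (E ∪ E')).updateRow r (Pi.single r 1) := by
    ext1 i j
    by_cases hi : i = r
    · subst hi
      have : ∀ k, lapPencil E' i k = if k = i then X else 0 := fun k => by
        rw [← lapPencil_col hr, lapPencil_isSymm E' |>.apply]
      simp [mul_apply, this]
    · have h2 := congrFun (congrFun (lapPencil_mul_lapPencil h') i) j
      rw [Finset.union_comm] at h2
      simp only [Matrix.smul_apply, updateRow_ne hi]
      rw [Matrix.smul_apply] at h2
      rw [← h2, mul_apply, mul_apply]
      refine Finset.sum_congr rfl fun k _ => ?_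
      by_cases hk : k = r
      · subst hk; rw [lapPencil_col hr, if_neg hi]; simp
      · rw [updateRow_ne hk]
  rw [updateRow_mul, h1]
  ext i j
  by_cases hi : i = u
  · subst hi
    simp only [updateRow_self, Matrix.smul_apply]
    rw [single_one_vecMul, row, updateRow_ne hru.symm]
    have := lapPencil_isSymm E |>.apply i j
    rw [← this, lapPencil_col hu]
    simp [Pi.single_apply]
  · simp [hi]

/-- The effect of joining two disjoint graphs by the edge `s(r, u)` on the determinant. -/
lemma lapDet_insert_union (h : ∀ e ∈ E, ∀ e' ∈ E', ∀ v ∈ e, v ∉ e')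
    (hr : ∀ e ∈ E', r ∉ e) (hu : ∀ e ∈ E, u ∉ e) (hru : r ≠ u) :
    X ^ Fintype.card V * lapDet (insert s(r, u) (E ∪ E')) =
      lapDet E * lapDet E' + lapMinor E r * lapDet E' + lapDet E * lapMinor E' u := by
  have h' : ∀ e' ∈ E', ∀ e ∈ E, ∀ v ∈ e', v ∉ e := fun e' he' e he v hv' hv => h e he e' he' v hv hv'
  have hnot : s(r, u) ∉ E ∪ E' := by
    rw [Finset.mem_union, not_or]
    exact ⟨fun he => hu _ he (Sym2.mem_mk_right r u), fun he => hr _ he (Sym2.mem_mk_left r u)⟩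
  rw [lapDet_insert hnot hru, adjugate_lapPencil_union_eq_zero h hr hu hru]
  have h1 := lapMinor_union h' hu
  rw [Finset.union_comm] at h1
  linear_combination lapDet_mul_lapDet h + lapMinor_union h hr + h1

/-- The effect of joining two disjoint graphs by the edge `s(r, u)` on the minor of `r`. -/
lemma lapMinor_insert_union (h : ∀ e ∈ E, ∀ e' ∈ E', ∀ v ∈ e, v ∉ e')
    (hr : ∀ e ∈ E', r ∉ e) (hu : ∀ e ∈ E, u ∉ e) (hru : r ≠ u) :
    X ^ Fintype.card V * lapMinor (insert s(r, u) (E ∪ E')) r =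
      lapMinor E r * (lapDet E' + lapMinor E' u) := by
  have hnot : s(r, u) ∉ E ∪ E' := by
    rw [Finset.mem_union, not_or]
    exact ⟨fun he => hu _ he (Sym2.mem_mk_right r u), fun he => hr _ he (Sym2.mem_mk_left r u)⟩
  rw [lapMinor_insert hnot hru]
  linear_combination lapMinor_union h hr + lapMinorTwo_union h hr hu hru

end Bridge

lemma lapDet_empty : lapDet (∅ : Finset (Sym2 V)) = X ^ Fintype.card V := by
  simp [lapDet, lapPencil]

lemma X_mul_lapMinor_of_isolated {E : Finset (Sym2 V)} {z : V} (h : ∀ e ∈ E, z ∉ e) :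
    X * lapMinor E z = lapDet E := by
  rw [lapMinor, mul_adjugate_of_mulVec_single (lapPencil_mulVec_single h), if_pos rfl, lapDet]

/-- An isolated vertex makes the minors at the other vertices divisible by `X`. -/
lemma X_dvd_lapMinor_of_isolated {E : Finset (Sym2 V)} {r z : V} (h : ∀ e ∈ E, z ∉ e)
    (hrz : r ≠ z) : X ∣ lapMinor E r := by
  have h1 : (lapPencil E).updateRow r (Pi.single r 1) *ᵥ Pi.single z 1 =
      (X : ℝ[X]) • Pi.single z 1 := by
    ext1 i
    by_cases hi : i = r
    · subst hi; simp [hrz]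
    · simp [hi, lapPencil_col h, Pi.single_apply]
  have h2 := mul_adjugate_of_mulVec_single h1 z
  rw [if_pos rfl] at h2
  rw [lapMinor, adjugate_apply, ← h2]
  exact dvd_mul_right _ _

end Pencil

/-! ### The bounds carried by the induction. -/

/-- Coefficientwise bounds for the determinant `f` and an end minor `g` of `X + L`, for a connected
graph with `M` edges among `N` vertices, all other vertices being isolated: upper bounds by the path
with `M` edges, and either lower bounds that hold for trees or a gap in the upper bound. -/
structure PathBounds (N M : ℕ) (f g : ℝ[X]) : Prop where
  -- The graph has `N` vertices, the path `M + 1`, and either number may be the larger; the powers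
  -- of `X` pad both with isolated vertices to `N + M + 1`.
  det_le : X ^ N * pathDet M - X ^ (M + 1) * f ∈ coeffNonneg
  minor_le : X ^ N * pathMinor M - X ^ (M + 1) * g ∈ coeffNonneg
  -- The third lower bound, on `f - X * g`, is what becomes the gap once an edge closes a cycle in a
  -- tree.
  lower_or_gap :
    (X ^ (M + 1) * g - X ^ N * (1 + X) ^ M ∈ coeffNonneg ∧
      X ^ (M + 1) * f - X ^ N * (X * (1 + X) ^ M) ∈ coeffNonneg ∧
      (1 ≤ M → X ^ (M + 1) * (f - X * g) - X ^ N * (X * (1 + X) ^ (M - 1)) ∈ coeffNonneg)) ∨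
    (2 ≤ M ∧ X ^ N * pathDet M - X ^ (M + 1) * f - X ^ N * (X * (1 + X) ^ (M - 2)) ∈ coeffNonneg)

namespace PathBounds

variable {N M M' : ℕ} {f g f' g' f₁ g₁ c m : ℝ[X]}

lemma of_no_edges (hg : X * g = X ^ N) : PathBounds N 0 (X ^ N) g where
  det_le := by
    rw [pathDet_zero]; convert zero_mem coeffNonneg using 1; ring
  minor_le := by
    rw [pathMinor_zero]; convert zero_mem coeffNonneg using 1; linear_combination -hg
  lower_or_gap := by
    refine Or.inl ⟨?_, ?_, fun h => absurd h (by norm_num)⟩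
    · convert zero_mem coeffNonneg using 1; linear_combination hg
    · convert zero_mem coeffNonneg using 1; ring

lemma gap_of_cycle (hr : PathBounds N M f g) (hfg : f - X * g ∈ coeffNonneg) (hM : 1 ≤ M) :
    X * (X ^ N * pathDet M - X ^ (M + 1) * f) + (X ^ N * pathDet M - X ^ (M + 1) * f) +
      X ^ (M + 1) * (f - X * g) - X ^ N * (X * (1 + X) ^ (M - 1)) ∈ coeffNonneg := by
  have hX := X_mem_coeffNonneg
  rcases hr.lower_or_gap with ⟨-, -, h⟩ | ⟨h2, h⟩
  · convert add_mem (add_mem (mul_mem hX hr.det_le) hr.det_le) (h hM) using 1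
    ring
  · obtain ⟨k, rfl⟩ := Nat.exists_eq_add_of_le' h2
    rw [show k + 2 - 2 = k by omega] at h
    rw [show k + 2 - 1 = k + 1 by omega]
    convert add_mem (mul_mem (add_mem (one_mem _) hX) h)
      (mul_mem (pow_mem hX (k + 2 + 1)) hfg) using 1
    ring

/-- Such an edge uses up no new vertex, so `f + g + g' - 2c` is multiplied by a further `X` before
it is compared with `P + X P + X Q`. The inequality `X g ≤ f` pays for the surplus minor, and its
slack gives the gap. -/
lemma insert_cycle_edge (hr : PathBounds N M f g) (hu : PathBounds N M f g')
    (hfg : f - X * g ∈ coeffNonneg) (hgm : g - X * m ∈ coeffNonneg) (hc : c ∈ coeffNonneg)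
    (hM : 1 ≤ M) (hf₁ : f₁ = f + g + g' - 2 * c) (hg₁ : g₁ = g + m) :
    PathBounds N (M + 1) f₁ g₁ := by
  have hX := X_mem_coeffNonneg
  have hXM := pow_mem hX (M + 1)
  have hgap := add_mem (gap_of_cycle hr hfg hM) (add_mem (mul_mem hX hu.minor_le)
    (mul_mem hXM (mul_mem hX (add_mem hc hc))))
  refine ⟨?_, ?_, Or.inr ⟨by omega, ?_⟩⟩
  · rw [pathDet_succ, hf₁]
    convert add_mem (add_mem (add_mem (mul_mem hX hr.det_le) hr.det_le)
      (mul_mem hX hu.minor_le)) (mul_mem hXM (add_mem hfg (mul_mem hX (add_mem hc hc)))) using 1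
    ring
  · rw [pathMinor_succ', hg₁]
    convert add_mem (add_mem hr.det_le hr.minor_le) (mul_mem hXM (add_mem hfg hgm)) using 1
    ring
  · rw [pathDet_succ, hf₁, show M + 1 - 2 = M - 1 by omega]
    convert hgap using 1
    ring

/-- The formulas for `f₁` and `g₁` are monotone in the data of both sides. Lower bounds on both
sides give lower bounds; a gap on one side survives multiplication by `P + Q` of the other. -/
lemma insert_bridge (h : PathBounds N M f g) (h' : PathBounds N M' f' g')
    (hf : f ∈ coeffNonneg) (hg : g ∈ coeffNonneg) (hf' : f' ∈ coeffNonneg) (hg' : g' ∈ coeffNonneg)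
    (hfg : f - X * g ∈ coeffNonneg)
    (hf₁ : X ^ N * f₁ = f * f' + g * f' + f * g') (hg₁ : X ^ N * g₁ = g * (f' + g')) :
    PathBounds N (M + M' + 1) f₁ g₁ := by
  have hX := X_mem_coeffNonneg
  have hY := pow_mem hX N
  have ha := pow_mem hX (M + 1)
  have hb := pow_mem hX (M' + 1)
  have hab : (X : ℝ[X]) ^ (M + M' + 1 + 1) = X ^ (M + 1) * X ^ (M' + 1) := by ring
  have hP := mul_mem hY (pathDet_mem M)
  have hP' := mul_mem hY (pathDet_mem M')
  have hQ := mul_mem hY (pathMinor_mem M)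
  have hQ' := mul_mem hY (pathMinor_mem M')
  -- `P + Q` is the end minor of the path with one more edge, so it raises the exponent in the gap
  -- by `k + 1`.
  have htail : ∀ k, X ^ N * pathDet k + X ^ N * pathMinor k - X ^ N * (1 + X) ^ (k + 1) ∈
      coeffNonneg := fun k => by
    convert mul_mem hY (pathMinor_pathDet_lower (k + 1)).1 using 1
    rw [pathMinor_succ']; ring
  refine ⟨?_, ?_, ?_⟩
  · rw [← X_pow_mul_mem_coeffNonneg N, hab, pathDet_add_add_one]
    convert add_mem (add_mem (add_mem (mul_mem h.det_le (add_mem hP' hQ'))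
      (mul_mem (mul_mem ha hf) (add_mem h'.det_le h'.minor_le))) (mul_mem h.minor_le hP'))
      (mul_mem (mul_mem ha hg) h'.det_le) using 1
    linear_combination -X ^ (M + 1) * X ^ (M' + 1) * hf₁
  · rw [← X_pow_mul_mem_coeffNonneg N, hab]
    convert add_mem (add_mem (mul_mem (mul_mem hY hY) (pathMinor_add_add_one M M'))
      (mul_mem h.minor_le (add_mem hP' hQ')))
      (mul_mem (mul_mem ha hg) (add_mem h'.det_le h'.minor_le)) using 1
    linear_combination -X ^ (M + 1) * X ^ (M' + 1) * hg₁
  · rcases h.lower_or_gap with ⟨lg, lf, -⟩ | ⟨h2, hgap⟩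
    · rcases h'.lower_or_gap with ⟨lg', lf', -⟩ | ⟨h2', hgap'⟩
      · left
        have hF' := mul_mem hb (add_mem hf' hg')
        refine ⟨?_, ?_, fun _ => ?_⟩
        · rw [← X_pow_mul_mem_coeffNonneg N, hab]
          convert add_mem (mul_mem lg hF') (mul_mem (mul_mem hY (one_add_X_pow_mem_coeffNonneg M))
            (add_mem lf' lg')) using 1
          linear_combination X ^ (M + 1) * X ^ (M' + 1) * hg₁
        · rw [← X_pow_mul_mem_coeffNonneg N, hab]
          convert add_mem (add_mem (mul_mem lf hF') (mul_mem (mul_mem hY (mul_mem hX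
            (one_add_X_pow_mem_coeffNonneg M))) (add_mem lf' lg')))
            (mul_mem (mul_mem ha hg) (mul_mem hb hf')) using 1
          linear_combination X ^ (M + 1) * X ^ (M' + 1) * hf₁
        -- Here `X ^ N * (f₁ - X * g₁) = (f - X * g) * (f' + g') + g * f'`, and `g * f'` alone
        -- supplies the bound.
        · rw [← X_pow_mul_mem_coeffNonneg N, hab, show M + M' + 1 - 1 = M + M' by omega]
          convert add_mem (add_mem (mul_mem (mul_mem ha hfg) hF') (mul_mem lg (mul_mem hb hf')))
            (mul_mem (mul_mem hY (one_add_X_pow_mem_coeffNonneg M)) lf') using 1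
          linear_combination X ^ (M + 1) * X ^ (M' + 1) * (hf₁ - X * hg₁)
      · right
        refine ⟨by omega, ?_⟩
        obtain ⟨k, rfl⟩ := Nat.exists_eq_add_of_le' h2'
        rw [show k + 2 - 2 = k by omega] at hgap'
        rw [← X_pow_mul_mem_coeffNonneg N, hab, pathDet_add_add_one,
          show M + (k + 2) + 1 - 2 = k + (M + 1) by omega]
        convert add_mem (add_mem (add_mem (add_mem (mul_mem hgap' (add_mem hP hQ))
          (mul_mem (mul_mem hb hf') (add_mem h.det_le h.minor_le))) (mul_mem h'.minor_le hP))
          (mul_mem (mul_mem hb hg') h.det_le))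
          (mul_mem (mul_mem hY (mul_mem hX (one_add_X_pow_mem_coeffNonneg k))) (htail M)) using 1
        linear_combination -X ^ (M + 1) * X ^ (k + 2 + 1) * hf₁
    · right
      refine ⟨by omega, ?_⟩
      obtain ⟨k, rfl⟩ := Nat.exists_eq_add_of_le' h2
      rw [show k + 2 - 2 = k by omega] at hgap
      rw [← X_pow_mul_mem_coeffNonneg N, hab, pathDet_add_add_one,
        show k + 2 + M' + 1 - 2 = k + (M' + 1) by omega]
      convert add_mem (add_mem (add_mem (add_mem (mul_mem hgap (add_mem hP' hQ'))
        (mul_mem (mul_mem ha hf) (add_mem h'.det_le h'.minor_le))) (mul_mem h.minor_le hP'))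
        (mul_mem (mul_mem ha hg) h'.det_le))
        (mul_mem (mul_mem hY (mul_mem hX (one_add_X_pow_mem_coeffNonneg k))) (htail M')) using 1
      linear_combination -X ^ (k + 2 + 1) * X ^ (M' + 1) * hf₁

end PathBounds

lemma SimpleGraph.Reachable.of_closed {V : Type*} {H : SimpleGraph V} {r v : V} {P : V → Prop}
    (h : H.Reachable r v) (hr : P r) (hP : ∀ a b, H.Adj a b → P a → P b) : P v := by
  obtain ⟨p⟩ := h
  induction p with
  | nil => exact hr
  | cons hab _ ih => exact ih (hP _ _ hab hr)

/-! ### Induction over connected edge sets. -/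

section Induction

open SimpleGraph

variable {V : Type*} [Fintype V] [DecidableEq V]

/-- Every vertex that is met by an edge in `E` can be reached from `r` along edges in `E`. -/
def EdgesReachable (E : Finset (Sym2 V)) (r : V) : Prop :=
  ∀ e ∈ E, ∀ v ∈ e, (fromEdgeSet (E : Set (Sym2 V))).Reachable r v

omit [Fintype V] [DecidableEq V] in
lemma EdgesReachable.exists_edge {E : Finset (Sym2 V)} {r : V} (h : EdgesReachable E r)
    (hE : E.Nonempty) : ∃ u, s(r, u) ∈ E := by
  obtain ⟨e, he⟩ := hE
  induction e with
  | h a b =>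
  by_contra hno
  push Not at hno
  have : a = r := (h _ he a (Sym2.mem_mk_left a b)).of_closed (P := fun v => v = r) rfl
    fun x y hxy hx => by
      subst hx
      exact absurd (by simpa using (fromEdgeSet_adj _ |>.1 hxy).1) (hno y)
  subst this
  exact hno b he

omit [Fintype V] in
lemma reachable_erase {E : Finset (Sym2 V)} {r u v : V}
    (h : (fromEdgeSet (E : Set (Sym2 V))).Reachable r v) :
    (fromEdgeSet (E.erase s(r, u) : Set (Sym2 V))).Reachable r v ∨
      (fromEdgeSet (E.erase s(r, u) : Set (Sym2 V))).Reachable u v := by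
  refine h.of_closed (P := fun v => (fromEdgeSet (E.erase s(r, u) : Set (Sym2 V))).Reachable r v ∨
      (fromEdgeSet (E.erase s(r, u) : Set (Sym2 V))).Reachable u v) (Or.inl (Reachable.refl _))
    fun a b hab hP => ?_
  rw [fromEdgeSet_adj] at hab
  by_cases he : s(a, b) = s(r, u)
  · rcases Sym2.eq_iff.1 he with ⟨-, rfl⟩ | ⟨-, rfl⟩
    · exact Or.inr (Reachable.refl _)
    · exact Or.inl (Reachable.refl _)
  · have hadj : (fromEdgeSet (E.erase s(r, u) : Set (Sym2 V))).Adj a b := by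
      rw [fromEdgeSet_adj]
      exact ⟨by simpa [he] using hab.1, hab.2⟩
    exact hP.imp (fun h => h.trans hadj.reachable) fun h => h.trans hadj.reachable

omit [Fintype V] [DecidableEq V] in
-- A walk from `r` along `E` stays in the component of `r`, and `E'` contains all edges of `E` in
-- that component.
lemma edgesReachable_of_reachable {E E' : Finset (Sym2 V)} {r : V}
    (hr : ∀ e ∈ E', ∀ v ∈ e, (fromEdgeSet (E : Set (Sym2 V))).Reachable r v)
    (hE : ∀ e ∈ E, (∀ v ∈ e, (fromEdgeSet (E : Set (Sym2 V))).Reachable r v) → e ∈ E') :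
    EdgesReachable E' r := by
  intro e he v hv
  refine ((hr e he v hv).of_closed (P := fun v => (fromEdgeSet (E : Set (Sym2 V))).Reachable r v ∧
    (fromEdgeSet (E' : Set (Sym2 V))).Reachable r v) ⟨Reachable.refl _, Reachable.refl _⟩
    fun a b hab hP => ?_).2
  have hb := hP.1.trans hab.reachable
  refine ⟨hb, hP.2.trans (Adj.reachable ?_)⟩
  rw [fromEdgeSet_adj] at hab ⊢
  refine ⟨Finset.mem_coe.2 (hE _ (Finset.mem_coe.1 hab.1) fun w hw => ?_), hab.2⟩
  rcases Sym2.mem_iff.1 hw with rfl | rfl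
  · exact hP.1
  · exact hb

open scoped Classical in
/-- The coefficientwise bounds hold for every connected graph. -/
theorem pathBounds_of_edgesReachable (E : Finset (Sym2 V)) (r : V) (hd : ∀ e ∈ E, ¬e.IsDiag)
    (hr : EdgesReachable E r) :
    PathBounds (Fintype.card V) E.card (lapDet E) (lapMinor E r) := by
  induction hn : E.card using Nat.strong_induction_on generalizing E r with
  | _ n ih =>
  subst hn
  rcases E.eq_empty_or_nonempty with rfl | hne
  · rw [Finset.card_empty, lapDet_empty]
    refine PathBounds.of_no_edges ?_
    rw [X_mul_lapMinor_of_isolated (by simp), lapDet_empty]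
  obtain ⟨u, hu⟩ := hr.exists_edge hne
  have hru : r ≠ u := fun h => hd _ hu (by simp [h])
  set E₀ := E.erase s(r, u) with hE₀
  have hins : E = insert s(r, u) E₀ := (Finset.insert_erase hu).symm
  have hnot : s(r, u) ∉ E₀ := Finset.notMem_erase _ _
  have hcard : E.card = E₀.card + 1 := (Finset.card_erase_add_one hu).symm
  have hd₀ : ∀ e ∈ E₀, ¬e.IsDiag := fun e he => hd e (Finset.mem_of_mem_erase he)
  have hreach : ∀ e ∈ E₀, ∀ v ∈ e, (fromEdgeSet (E₀ : Set (Sym2 V))).Reachable r v ∨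
      (fromEdgeSet (E₀ : Set (Sym2 V))).Reachable u v := fun e he v hv =>
    reachable_erase (hr e (Finset.mem_of_mem_erase he) v hv)
  -- Either `s(r, u)` closes a cycle, or it is a bridge and the other edges split into those on the
  -- side of `r` and those on the side of `u`.
  by_cases hcyc : (fromEdgeSet (E₀ : Set (Sym2 V))).Reachable r u
  · have hr₀ : EdgesReachable E₀ r := fun e he v hv =>
      (hreach e he v hv).elim id fun h => hcyc.trans h
    have hu₀ : EdgesReachable E₀ u := fun e he v hv => hcyc.symm.trans (hr₀ e he v hv)
    have hM : 1 ≤ E₀.card := by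
      rw [Nat.one_le_iff_ne_zero, Finset.card_ne_zero]
      by_contra hemp
      rw [Finset.not_nonempty_iff_eq_empty] at hemp
      exact hru (hcyc.of_closed (P := fun v => r = v) rfl fun a b hab => by simp [hemp] at hab)
    rw [hcard]
    refine PathBounds.insert_cycle_edge (ih _ (by omega) E₀ r hd₀ hr₀ rfl)
      (ih _ (by omega) E₀ u hd₀ hu₀ rfl) (lapDet_sub_X_mul_lapMinor_mem E₀ r)
      (lapMinor_sub_X_mul_lapMinorTwo_mem E₀ hru) (adjugate_lapPencil_mem E₀ r u) hM ?_ ?_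
    · rw [hins, lapDet_insert hnot hru]
    · rw [hins, lapMinor_insert hnot hru]
  · set E₁ := E₀.filter fun e => ∀ v ∈ e, (fromEdgeSet (E₀ : Set (Sym2 V))).Reachable r v with hE₁
    set E₂ := E₀.filter fun e => ¬∀ v ∈ e, (fromEdgeSet (E₀ : Set (Sym2 V))).Reachable r v with hE₂
    have hunion : E₁ ∪ E₂ = E₀ := Finset.filter_union_filter_not_eq _ _
    have hcard₀ : E₁.card + E₂.card = E₀.card := Finset.card_filter_add_card_filter_not _
    have h₁ : ∀ e ∈ E₁, ∀ v ∈ e, (fromEdgeSet (E₀ : Set (Sym2 V))).Reachable r v := fun e he =>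
      (Finset.mem_filter.1 he).2
    have h₂ : ∀ e ∈ E₂, ∀ v ∈ e, ¬(fromEdgeSet (E₀ : Set (Sym2 V))).Reachable r v := by
      intro e he v hv hrv
      rw [hE₂, Finset.mem_filter] at he
      refine he.2 fun w hw => ?_
      by_cases hvw : v = w
      · exact hvw ▸ hrv
      · refine hrv.trans (Adj.reachable ?_)
        rw [fromEdgeSet_adj]
        refine ⟨?_, hvw⟩
        rw [← (Sym2.mem_and_mem_iff hvw).1 ⟨hv, hw⟩]
        exact he.1
    have h₂' : ∀ e ∈ E₂, ∀ v ∈ e, (fromEdgeSet (E₀ : Set (Sym2 V))).Reachable u v :=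
      fun e he v hv => (hreach e (Finset.mem_filter.1 he).1 v hv).resolve_left (h₂ e he v hv)
    have hdisj : ∀ e ∈ E₁, ∀ e' ∈ E₂, ∀ v ∈ e, v ∉ e' := fun e he e' he' v hv hv' =>
      h₂ e' he' v hv' (h₁ e he v hv)
    have hr₂ : ∀ e ∈ E₂, r ∉ e := fun e he hv => h₂ e he r hv (Reachable.refl _)
    have hu₁ : ∀ e ∈ E₁, u ∉ e := fun e he hv => hcyc (h₁ e he u hv)
    have hR₁ : EdgesReachable E₁ r := edgesReachable_of_reachable h₁ fun e he h =>
      Finset.mem_filter.2 ⟨he, h⟩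
    have hR₂ : EdgesReachable E₂ u := edgesReachable_of_reachable h₂' fun e he h =>
      Finset.mem_filter.2 ⟨he, fun h' => by
        induction e with
        | h a b =>
          have ha := Sym2.mem_mk_left a b
          exact hcyc ((h' a ha).trans (h a ha).symm)⟩
    rw [hcard, ← hcard₀]
    refine PathBounds.insert_bridge
      (ih _ (by omega) E₁ r (fun e he => hd₀ e (Finset.mem_filter.1 he).1) hR₁ rfl)
      (ih _ (by omega) E₂ u (fun e he => hd₀ e (Finset.mem_filter.1 he).1) hR₂ rfl)
      (lapDet_mem _) (lapMinor_mem _ _) (lapDet_mem _) (lapMinor_mem _ _)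
      (lapDet_sub_X_mul_lapMinor_mem _ _) ?_ ?_
    · rw [hins, ← hunion, lapDet_insert_union hdisj hr₂ hu₁ hru]
    · rw [hins, ← hunion, lapMinor_insert_union hdisj hr₂ hu₁ hru]

end Induction

/-! ### Coefficients of the Laplacian polynomial as coefficients of `det (X + L)`. -/

section Laplacian

variable {V : Type*} [Fintype V] [DecidableEq V]

omit [Fintype V] in
lemma edgeLap_apply_eq_incMatrix (H : SimpleGraph V) [DecidableRel H.Adj] {e : Sym2 V}
    (he : e ∈ H.edgeSet) (i j : V) : edgeLap e i j =
      (if i = j then 1 else -1) * (H.incMatrix ℝ[X] i e * H.incMatrix ℝ[X] j e) := by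
  induction e with
  | h a b =>
  have hab : a ≠ b := H.ne_of_adj he
  simp only [edgeLap_mk, vecMulVec_apply, SimpleGraph.incMatrix_apply',
    SimpleGraph.mk'_mem_incidenceSet_iff, H.mem_edgeSet.1 he, true_and, Pi.sub_apply,
    Pi.single_apply]
  split_ifs <;> simp_all

lemma sum_edgeLap_eq_lapMatrix (H : SimpleGraph V) [DecidableRel H.Adj] {E : Finset (Sym2 V)}
    (hE : (E : Set (Sym2 V)) = H.edgeSet) :
    ∑ e ∈ E, edgeLap e = H.lapMatrix ℝ[X] := by
  have hmem : ∀ e, e ∈ E ↔ e ∈ H.edgeSet := fun e => by rw [← hE, Finset.mem_coe]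
  ext1 i j
  have h1 : (∑ e ∈ E, edgeLap e) i j =
      (if i = j then 1 else -1) * (H.incMatrix ℝ[X] * (H.incMatrix ℝ[X])ᵀ) i j := by
    rw [Matrix.sum_apply, mul_apply, Finset.mul_sum,
      Finset.sum_congr rfl fun e he => edgeLap_apply_eq_incMatrix H ((hmem e).1 he) i j]
    refine Finset.sum_subset (Finset.subset_univ _) fun e _ he => ?_
    rw [H.incMatrix_of_notMem_incidenceSet fun h => he ((hmem e).2 h.1)]
    simp
  rw [h1, SimpleGraph.incMatrix_mul_transpose]
  by_cases hij : i = j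
  · subst hij
    simp [SimpleGraph.lapMatrix, SimpleGraph.degMatrix]
  · by_cases hadj : H.Adj i j <;>
      simp [hij, hadj, SimpleGraph.lapMatrix, SimpleGraph.degMatrix, SimpleGraph.adjMatrix_apply]

lemma coeff_lapDet_eq_coeff_charpoly (H : SimpleGraph V) [DecidableRel H.Adj]
    {E : Finset (Sym2 V)} (hE : (E : Set (Sym2 V)) = H.edgeSet) (k : ℕ) :
    (lapDet E).coeff k = (-1) ^ (Fintype.card V + k) * (H.lapMatrix ℝ).charpoly.coeff k := by
  have hmap : (compRingHom (C (-1) * X)).mapMatrix (H.lapMatrix ℝ).charmatrix =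
      (-1 : ℝ[X]) • lapPencil E := by
    rw [lapPencil, sum_edgeLap_eq_lapMatrix H hE]
    ext1 i j
    by_cases hij : i = j
    · subst hij
      simp [SimpleGraph.lapMatrix, SimpleGraph.degMatrix]
      ring
    · by_cases hadj : H.Adj i j <;>
        simp [hij, hadj, SimpleGraph.lapMatrix, SimpleGraph.degMatrix,
          SimpleGraph.adjMatrix_apply, charmatrix_apply_ne]
  have h1 : (H.lapMatrix ℝ).charpoly.comp (C (-1) * X) = (-1) ^ Fintype.card V * lapDet E := by
    rw [← coe_compRingHom_apply, charpoly, RingHom.map_det, hmap, det_smul, lapDet]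
  have h2 := congrArg (fun p => p.coeff k) h1
  simp only [comp_C_mul_X_coeff] at h2
  have h3 : ((-1) ^ Fintype.card V * lapDet E).coeff k =
      (-1) ^ Fintype.card V * (lapDet E).coeff k := by
    rw [← C_1, ← C_neg, ← C_pow, coeff_C_mul]
  rw [h3] at h2
  have h4 : ((-1 : ℝ) ^ Fintype.card V) * (-1) ^ Fintype.card V = 1 := by
    rw [← mul_pow]; simp
  rw [pow_add]
  linear_combination (-1 : ℝ) ^ Fintype.card V * -h2 - (lapDet E).coeff k * h4

open LaplacianOrder in
lemma lapCoeff_eq_coeff_lapDet (H : SimpleGraph V) {E : Finset (Sym2 V)}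
    (hE : (E : Set (Sym2 V)) = H.edgeSet) {s : ℕ} (hs : s < Fintype.card V) :
    lapCoeff H s = (lapDet E).coeff (Fintype.card V - s) := by
  classical
  -- `laplacianPoly` is built with the classical instance, which is identified here with the ambient
  -- one.
  obtain rfl : (fun a b => Classical.propDecidable (a = b)) = ‹DecidableEq V› :=
    Subsingleton.elim _ _
  rw [coeff_lapDet_eq_coeff_charpoly H hE, lapCoeff, laplacianPoly, coeff_divX,
    show Fintype.card V - 1 - s + 1 = Fintype.card V - s by omega]
  have : (-1 : ℝ) ^ (Fintype.card V + (Fintype.card V - s)) = (-1) ^ s := by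
    rw [neg_one_pow_eq_pow_mod_two, neg_one_pow_eq_pow_mod_two (n := s)]
    congr 1
    omega
  rw [this]

end Laplacian

/-! ### The determinant of the cycle. -/

section Cycle

variable {n : ℕ}

/-- The edges of the path through the first `k + 1` vertices. -/
def pathEdges (n : ℕ) : ℕ → Finset (Sym2 (Fin (n + 1)))
  | 0 => ∅
  | k + 1 => insert s(Fin.ofNat (n + 1) (k + 1), Fin.ofNat (n + 1) k) (pathEdges n k)

lemma ofNat_inj {a b : ℕ} (ha : a ≤ n) (hb : b ≤ n) :
    Fin.ofNat (n + 1) a = Fin.ofNat (n + 1) b ↔ a = b := by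
  rw [Fin.ext_iff, Fin.val_ofNat, Fin.val_ofNat, Nat.mod_eq_of_lt (by omega),
    Nat.mod_eq_of_lt (by omega)]

lemma mem_pathEdges {k : ℕ} {e : Sym2 (Fin (n + 1))} : e ∈ pathEdges n k ↔
    ∃ i < k, e = s(Fin.ofNat (n + 1) (i + 1), Fin.ofNat (n + 1) i) := by
  induction k with
  | zero => simp [pathEdges]
  | succ k ih =>
    rw [pathEdges, Finset.mem_insert, ih]
    constructor
    · rintro (rfl | ⟨i, hi, rfl⟩)
      · exact ⟨k, by omega, rfl⟩
      · exact ⟨i, by omega, rfl⟩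
    · rintro ⟨i, hi, rfl⟩
      rcases Nat.lt_succ_iff_lt_or_eq.1 hi with h | rfl
      · exact Or.inr ⟨i, h, rfl⟩
      · exact Or.inl rfl

lemma notMem_of_mem_pathEdges {k z : ℕ} (hkz : k < z) (hz : z ≤ n) :
    ∀ e ∈ pathEdges n k, Fin.ofNat (n + 1) z ∉ e := by
  intro e he
  obtain ⟨i, hi, rfl⟩ := mem_pathEdges.1 he
  rw [Sym2.mem_iff, ofNat_inj hz (by omega), ofNat_inj hz (by omega)]
  omega

lemma pathEdge_notMem {k : ℕ} (hk : k < n) :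
    s(Fin.ofNat (n + 1) (k + 1), Fin.ofNat (n + 1) k) ∉ pathEdges n k := fun h =>
  notMem_of_mem_pathEdges (Nat.lt_succ_self k) hk _ h (Sym2.mem_mk_left _ _)

lemma card_pathEdges {k : ℕ} (hk : k ≤ n) : (pathEdges n k).card = k := by
  induction k with
  | zero => rfl
  | succ k ih => rw [pathEdges, Finset.card_insert_of_notMem (pathEdge_notMem hk), ih (by omega)]

lemma lapDet_lapMinor_pathEdges {k : ℕ} (hk : k ≤ n) :
    X ^ (k + 1) * lapDet (pathEdges n k) = X ^ (n + 1) * pathDet k ∧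
    X ^ (k + 1) * lapMinor (pathEdges n k) (Fin.ofNat (n + 1) k) = X ^ (n + 1) * pathMinor k := by
  have h0 : ∀ z : Fin (n + 1), X * lapMinor ∅ z = X ^ (n + 1) := fun z => by
    rw [X_mul_lapMinor_of_isolated (by simp), lapDet_empty, Fintype.card_fin]
  induction k with
  | zero =>
    refine ⟨?_, ?_⟩
    · rw [pathEdges, lapDet_empty, Fintype.card_fin, pathDet_zero]; ring
    · rw [pathEdges, zero_add, pow_one, h0, pathMinor_zero, mul_one]
  | succ k ih =>
    obtain ⟨hf, hg⟩ := ih (by omega)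
    have hr := notMem_of_mem_pathEdges (n := n) (Nat.lt_succ_self k) hk
    have hru : Fin.ofNat (n + 1) (k + 1) ≠ Fin.ofNat (n + 1) k := by
      rw [Ne, ofNat_inj hk (by omega)]; omega
    have h1 := lapDet_insert_union (E := ∅) (by simp) hr (by simp) hru
    have h2 := lapMinor_insert_union (E := ∅) (by simp) hr (by simp) hru
    rw [Finset.empty_union, Fintype.card_fin] at h1 h2
    rw [lapDet_empty, Fintype.card_fin] at h1
    have hX : (X : ℝ[X]) ^ (n + 1) ≠ 0 := pow_ne_zero _ X_ne_zero
    constructor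
    · apply mul_left_cancel₀ hX
      rw [pathDet_succ, pathEdges]
      linear_combination X ^ (k + 1 + 1) * h1 + X ^ (k + 1) * lapDet (pathEdges n k) *
        h0 (Fin.ofNat (n + 1) (k + 1)) + X ^ (n + 1) * ((1 + X) * hf + X * hg)
    · apply mul_left_cancel₀ hX
      rw [pathMinor_succ', pathEdges]
      linear_combination X ^ (k + 1 + 1) * h2 + X ^ (k + 1) * (lapDet (pathEdges n k) +
        lapMinor (pathEdges n k) (Fin.ofNat (n + 1) k)) *
        h0 (Fin.ofNat (n + 1) (k + 1)) + X ^ (n + 1) * (hf + hg)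

lemma lapDet_pathEdges (n : ℕ) : lapDet (pathEdges n n) = pathDet n :=
  mul_left_cancel₀ (pow_ne_zero _ X_ne_zero) (lapDet_lapMinor_pathEdges le_rfl).1

lemma lapMinor_pathEdges (n : ℕ) :
    lapMinor (pathEdges n n) (Fin.ofNat (n + 1) n) = pathMinor n :=
  mul_left_cancel₀ (pow_ne_zero _ X_ne_zero) (lapDet_lapMinor_pathEdges le_rfl).2

lemma lapPencil_pathEdges_eq {k : ℕ} (hk : k ≤ n) : lapPencil (pathEdges n k) =
    (X : ℝ[X]) • 1 + ∑ i ∈ Finset.range k,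
      edgeLap s(Fin.ofNat (n + 1) (i + 1), Fin.ofNat (n + 1) i) := by
  induction k with
  | zero => simp [pathEdges, lapPencil]
  | succ k ih =>
    rw [pathEdges, lapPencil_insert (pathEdge_notMem hk), ih (by omega), Finset.sum_range_succ,
      add_assoc]

/-- This solves the recursion along the path from its far end; it yields the column of the adjugate
at vertex `0`, whose last entry is the `1` in the cycle's formula. -/
lemma lapPencil_pathEdges_mulVec (n : ℕ) :
    lapPencil (pathEdges n n) *ᵥ (fun i => pathMinor (n - i)) =
      pathDet n • Pi.single (Fin.ofNat (n + 1) 0) 1 := by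
  set v : Fin (n + 1) → ℝ[X] := fun i => pathMinor (n - i) with hv
  set c : ℕ → Fin (n + 1) → ℝ[X] := fun i => Pi.single (Fin.ofNat (n + 1) i) 1 with hc
  have hvc : ∀ i ≤ n, v (Fin.ofNat (n + 1) i) = pathMinor (n - i) := fun i hi => by
    simp only [hv, Fin.val_ofNat]
    rw [Nat.mod_eq_of_lt (by omega)]
  have hedge : ∀ i < n, edgeLap s(Fin.ofNat (n + 1) (i + 1), Fin.ofNat (n + 1) i) *ᵥ v =
      (X * pathAux (n - i)) • (c i - c (i + 1)) := by
    intro i hi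
    rw [edgeLap_mk, vecMulVec_mulVec, sub_dotProduct, single_one_dotProduct, single_one_dotProduct,
      hvc _ hi, hvc _ hi.le]
    obtain ⟨j, hj⟩ : ∃ j, n - i = j + 1 := ⟨n - i - 1, by omega⟩
    rw [hj, show n - (i + 1) = j by omega, pathMinor_succ]
    ext1 k
    simp [hc]
    ring
  have hXv : (X : ℝ[X]) • v = ∑ i ∈ Finset.range (n + 1), (X * pathMinor (n - i)) • c i := by
    rw [Finset.sum_range]
    ext1 k
    simp [hc, Finset.sum_apply, Pi.single_apply, hv]
  rw [lapPencil_pathEdges_eq le_rfl, add_mulVec, sum_mulVec, smul_mulVec, one_mulVec, hXv,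
    Finset.sum_congr rfl fun i hi => hedge i (Finset.mem_range.1 hi)]
  -- The additional term `i = n` vanishes because `pathAux 0 = 0`; with it the whole sum telescopes.
  have hext : ∑ i ∈ Finset.range n, (X * pathAux (n - i)) • (c i - c (i + 1)) =
      ∑ i ∈ Finset.range (n + 1), (X * pathAux (n - i)) • (c i - c (i + 1)) := by
    rw [Finset.sum_range_succ, Nat.sub_self, pathAux_zero, mul_zero, zero_smul, add_zero]
  rw [hext, ← Finset.sum_add_distrib]
  have hterm : ∀ i ∈ Finset.range (n + 1), (X * pathMinor (n - i)) • c i +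
      (X * pathAux (n - i)) • (c i - c (i + 1)) =
      (X * pathAux (n + 1 - i)) • c i - (X * pathAux (n + 1 - (i + 1))) • c (i + 1) := by
    intro i hi
    have hi : i ≤ n := Nat.lt_succ_iff.1 (Finset.mem_range.1 hi)
    rw [show n + 1 - i = n - i + 1 by omega, show n + 1 - (i + 1) = n - i by omega, pathAux_succ]
    module
  rw [Finset.sum_congr rfl hterm,
    Finset.sum_range_sub' (fun i => (X * pathAux (n + 1 - i)) • c i), Nat.sub_self, pathAux_zero]
  simp [hc, pathDet]

lemma pathDet_ne_zero (n : ℕ) : pathDet n ≠ 0 := by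
  intro h
  have := (pathMinor_pathDet_lower n).2 1
  rw [h, zero_sub, coeff_neg, show (1 : ℕ) = 0 + 1 from rfl, coeff_X_mul,
    coeff_one_add_X_pow] at this
  norm_num at this

lemma adjugate_pathEdges (n : ℕ) (i : Fin (n + 1)) :
    (lapPencil (pathEdges n n)).adjugate i (Fin.ofNat (n + 1) 0) = pathMinor (n - i) := by
  have h1 := congrArg ((lapPencil (pathEdges n n)).adjugate *ᵥ ·) (lapPencil_pathEdges_mulVec n)
  simp only [mulVec_mulVec, adjugate_mul, mulVec_smul, smul_mulVec, one_mulVec] at h1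
  rw [← lapDet, lapDet_pathEdges, mulVec_single_one] at h1
  have h2 := congrFun h1 i
  exact (mul_left_cancel₀ (pathDet_ne_zero n) h2).symm

/-- The edges of the cycle with `n + 1` vertices. -/
def cycleEdges (n : ℕ) : Finset (Sym2 (Fin (n + 1))) :=
  insert s(Fin.ofNat (n + 1) n, Fin.ofNat (n + 1) 0) (pathEdges n n)

lemma closingEdge_notMem (hn : 2 ≤ n) :
    s(Fin.ofNat (n + 1) n, Fin.ofNat (n + 1) 0) ∉ pathEdges n n := by
  intro h
  obtain ⟨i, hi, he⟩ := mem_pathEdges.1 h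
  rw [Sym2.eq_iff] at he
  simp only [ofNat_inj le_rfl (show i + 1 ≤ n from hi), ofNat_inj (Nat.zero_le n) hi.le,
    ofNat_inj le_rfl hi.le, ofNat_inj (Nat.zero_le n) (show i + 1 ≤ n from hi)] at he
  omega

lemma card_cycleEdges (hn : 2 ≤ n) : (cycleEdges n).card = n + 1 := by
  rw [cycleEdges, Finset.card_insert_of_notMem (closingEdge_notMem hn), card_pathEdges le_rfl]

/-- The determinant of `X + L` for the cycle with `n + 1` vertices. -/
lemma lapDet_cycleEdges (hn : 2 ≤ n) :
    lapDet (cycleEdges n) = pathDet n + 2 * pathMinor n - 2 := by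
  have hne : Fin.ofNat (n + 1) n ≠ Fin.ofNat (n + 1) 0 := by
    rw [Ne, ofNat_inj le_rfl (Nat.zero_le n)]; omega
  have h0 : lapMinor (pathEdges n n) (Fin.ofNat (n + 1) 0) = pathMinor n := by
    rw [lapMinor, adjugate_pathEdges]; simp
  have h1 : (lapPencil (pathEdges n n)).adjugate (Fin.ofNat (n + 1) n) (Fin.ofNat (n + 1) 0) =
      1 := by
    rw [adjugate_pathEdges, Fin.val_ofNat, Nat.mod_eq_of_lt (by omega), Nat.sub_self,
      pathMinor_zero]
  rw [cycleEdges, lapDet_insert (closingEdge_notMem hn) hne, lapDet_pathEdges, lapMinor_pathEdges,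
    h0, h1]
  ring

lemma coe_cycleEdges (hn : 2 ≤ n) :
    (cycleEdges n : Set (Sym2 (Fin (n + 1)))) = (SimpleGraph.cycleGraph (n + 1)).edgeSet := by
  ext e
  induction e with
  | h a b =>
  rw [Finset.mem_coe, cycleEdges, Finset.mem_insert, mem_pathEdges, SimpleGraph.mem_edgeSet,
    SimpleGraph.cycleGraph_adj']
  have hval : ∀ i ≤ n, ∀ x : Fin (n + 1), x = Fin.ofNat (n + 1) i ↔ x.val = i := fun i hi x => by
    rw [Fin.ext_iff, Fin.val_ofNat, Nat.mod_eq_of_lt (by omega)]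
  have hsub : ∀ x y : Fin (n + 1), (x - y).val = 1 ↔
      x.val = y.val + 1 ∨ (x.val = 0 ∧ y.val = n) := by
    intro x y
    have hx := x.isLt
    have hy := y.isLt
    rw [Fin.val_sub]
    by_cases h : y.val ≤ x.val
    · rw [show n + 1 - y.val + x.val = (x.val - y.val) + (n + 1) by omega, Nat.add_mod_right,
        Nat.mod_eq_of_lt (by omega)]
      omega
    · rw [Nat.mod_eq_of_lt (by omega)]
      omega
  simp only [hsub, Sym2.eq_iff]
  rw [hval n le_rfl, hval 0 (Nat.zero_le n), hval n le_rfl, hval 0 (Nat.zero_le n)]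
  constructor
  · rintro (h | ⟨i, hi, h⟩)
    · omega
    · rw [hval _ hi, hval _ hi.le, hval _ hi, hval _ hi.le] at h
      omega
  · intro h
    by_cases hcl : (a.val = n ∧ b.val = 0) ∨ (a.val = 0 ∧ b.val = n)
    · exact Or.inl hcl
    · right
      have ha := a.isLt
      have hb := b.isLt
      by_cases hab : a.val = b.val + 1
      · refine ⟨b.val, by omega, Or.inl ?_⟩
        rw [hval _ (by omega), hval _ (by omega)]
        exact ⟨hab, rfl⟩
      · refine ⟨a.val, by omega, Or.inr ?_⟩
        rw [hval _ (by omega), hval _ (by omega)]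
        omega

end Cycle

/-! ### Bridgeless graphs with few edges, and adding isolated vertices. -/

namespace SimpleGraph

variable {V : Type*} [Fintype V] {G : SimpleGraph V}

lemma ncard_edgeSet_deleteEdges_add_one {e : Sym2 V} (he : e ∈ G.edgeSet) :
    Nat.card (G.deleteEdges {e}).edgeSet + 1 = G.edgeSet.ncard := by
  rw [Nat.card_coe_set_eq, edgeSet_deleteEdges, Set.ncard_sdiff_singleton_add_one he]

/-- A connected graph without bridges that has no more edges than vertices is a cycle. -/
lemma exists_iso_cycleGraph [Nontrivial V] (hG : G.Connected)
    (hdel : ∀ e, (G.deleteEdges {e}).Connected) (hcard : G.edgeSet.ncard ≤ Fintype.card V) :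
    ∃ k, 3 ≤ k ∧ Nonempty (G ≃g cycleGraph k) := by
  -- A tree with an edge deleted has too few edges to be connected.
  have hac : ¬G.IsAcyclic := by
    intro hac
    obtain ⟨v⟩ := hG.nonempty
    obtain ⟨w, hw⟩ := hG.preconnected.exists_adj_of_nontrivial v
    have h1 := (isTree_iff_connected_and_card.1 ⟨hG, hac⟩).2
    have h2 := (hdel s(v, w)).card_vert_le_card_edgeSet_add_one
    rw [ncard_edgeSet_deleteEdges_add_one hw] at h2
    rw [Nat.card_coe_set_eq] at h1
    omega
  rw [isAcyclic_iff_free_cycleGraph] at hac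
  push Not at hac
  obtain ⟨k, hk, hfree⟩ := hac
  obtain ⟨f⟩ := hfree
  -- Deleting an edge off the copy of the cycle would leave a connected graph with few enough edges
  -- to be a tree, yet still containing that cycle.
  have hedge : ∀ a b, G.Adj a b → ∃ c d, (cycleGraph k).Adj c d ∧ s(f c, f d) = s(a, b) := by
    intro a b hab
    by_contra hno
    push Not at hno
    have htree : (G.deleteEdges {s(a, b)}).IsTree := by
      rw [isTree_iff_connected_and_card, ncard_edgeSet_deleteEdges_add_one hab]
      refine ⟨hdel _, le_antisymm (by rwa [Nat.card_eq_fintype_card]) ?_⟩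
      have := (hdel s(a, b)).card_vert_le_card_edgeSet_add_one
      rwa [ncard_edgeSet_deleteEdges_add_one hab] at this
    refine isAcyclic_iff_free_cycleGraph.1 htree.isAcyclic k hk ⟨⟨⟨f, ?_⟩, f.injective⟩⟩
    intro c d hcd
    rw [deleteEdges_adj]
    exact ⟨f.toHom.map_adj hcd, hno c d hcd⟩
  have hsurj : Function.Surjective f := by
    intro v
    obtain ⟨w, hw⟩ := hG.preconnected.exists_adj_of_nontrivial v
    obtain ⟨c, d, -, he⟩ := hedge v w hw
    rcases Sym2.eq_iff.1 he with ⟨h, -⟩ | ⟨-, h⟩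
    · exact ⟨c, h⟩
    · exact ⟨d, h⟩
  refine ⟨k, hk, ⟨Iso.symm ⟨Equiv.ofBijective f ⟨f.injective, hsurj⟩, ?_⟩⟩⟩
  intro a b
  refine ⟨fun h => ?_, fun h => f.toHom.map_adj h⟩
  obtain ⟨c, d, hcd, he⟩ := hedge _ _ h
  rcases Sym2.eq_iff.1 he with ⟨h1, h2⟩ | ⟨h1, h2⟩
  · rwa [← f.injective h1, ← f.injective h2]
  · rw [← f.injective h1, ← f.injective h2]
    exact hcd.symm

omit [Fintype V] in
lemma edgeSet_sum_bot {W : Type*} :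
    (G.sum (⊥ : SimpleGraph W)).edgeSet = Sym2.map Sum.inl '' G.edgeSet := by
  ext e
  induction e with
  | h a b =>
  rw [mem_edgeSet]
  constructor
  · intro h
    rcases a with a | a <;> rcases b with b | b
    · exact ⟨s(a, b), by simpa using h, rfl⟩
    all_goals simp at h
  · rintro ⟨e, he, heq⟩
    induction e with
    | h c d =>
    rw [Sym2.map_mk] at heq
    rw [← mem_edgeSet, ← heq]
    simpa using he

end SimpleGraph

/-! ### Comparison with the cycle. -/

section Main

open SimpleGraph

/-- The coefficientwise comparison of a graph with the cycle: the graph has as many edges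
as vertices, a vertex `z` is isolated, the edges form a connected graph, and the edge `s(r, u)` is
not a bridge. -/
lemma lapDet_insert_lt_cycle {V : Type*} [Fintype V] [DecidableEq V] {E : Finset (Sym2 V)}
    {r u z : V} (hru : r ≠ u) (hrz : r ≠ z) (hnot : s(r, u) ∉ E) (hd : ∀ e ∈ E, ¬e.IsDiag)
    (hr : EdgesReachable E r) (hu : EdgesReachable E u) (hz : ∀ e ∈ E, z ∉ e)
    (hcard : E.card + 1 = Fintype.card V) {k : ℕ} (hk : 1 ≤ k) (hkE : k < E.card) :
    (lapDet (insert s(r, u) E)).coeff k <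
      (pathDet E.card + 2 * pathMinor E.card - 2 : ℝ[X]).coeff k := by
  have br := pathBounds_of_edgesReachable E r hd hr
  have bu := pathBounds_of_edgesReachable E u hd hu
  rw [← hcard] at br bu
  have hcancel : ∀ p q : ℝ[X], X ^ (E.card + 1) * p - X ^ (E.card + 1) * q ∈ coeffNonneg →
      p - q ∈ coeffNonneg := fun p q h => by
    rwa [← mul_sub, X_pow_mul_mem_coeffNonneg] at h
  have hgr := hcancel _ _ br.minor_le
  have hgu := hcancel _ _ bu.minor_le
  -- The lower bounds would give the minor at `r` a constant term of at least `1`, but the isolated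
  -- vertex `z` makes it divisible by `X`.
  have hgap : pathDet E.card - lapDet E - X * (1 + X) ^ (E.card - 2) ∈ coeffNonneg := by
    rcases br.lower_or_gap with ⟨hlow, -, -⟩ | ⟨-, h⟩
    · exfalso
      have h0 := hcancel _ _ hlow 0
      obtain ⟨q, hq⟩ := X_dvd_lapMinor_of_isolated hz hrz
      rw [hq, coeff_sub, coeff_one_add_X_pow, coeff_X_mul_zero] at h0
      norm_num at h0
    · rwa [← mul_sub, ← mul_sub, X_pow_mul_mem_coeffNonneg] at h
  have hc := adjugate_lapPencil_mem E r u
  have hsum := add_mem (add_mem hgap (add_mem hgr hgu)) (add_mem hc hc) k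
  have hpos : (0 : ℝ) < (X * (1 + X) ^ (E.card - 2) : ℝ[X]).coeff k := by
    obtain ⟨j, rfl⟩ := Nat.exists_eq_add_of_le' hk
    rw [coeff_X_mul, coeff_one_add_X_pow]
    exact_mod_cast Nat.choose_pos (by omega)
  have htwo : (2 : ℝ[X]).coeff k = 0 := by
    rw [show (2 : ℝ[X]) = C 2 from rfl, coeff_C, if_neg (by omega)]
  rw [lapDet_insert hnot hru, ← sub_pos, ← coeff_sub]
  have heq : pathDet E.card + 2 * pathMinor E.card - 2 -
      (lapDet E + lapMinor E r + lapMinor E u - 2 * (lapPencil E).adjugate r u) =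
      (pathDet E.card - lapDet E - X * (1 + X) ^ (E.card - 2) +
        (pathMinor E.card - lapMinor E r + (pathMinor E.card - lapMinor E u)) +
        ((lapPencil E).adjugate r u + (lapPencil E).adjugate r u)) +
      X * (1 + X) ^ (E.card - 2) - 2 := by ring
  rw [heq, coeff_sub, htwo, sub_zero, coeff_add]
  exact add_pos_of_nonneg_of_pos hsum hpos

end Main

open SimpleGraph LaplacianOrder in
theorem mainTheorem6 {V : Type*} [Fintype V] (G : SimpleGraph V) (n m : ℕ)
    (hsize : LaplacianOrder.HasSize G n m)
    (hconn : LaplacianOrder.TwoEdgeConnected G)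
    (hcyc : ¬ LaplacianOrder.IsCycleGraph G) :
    LaplacianOrder.StrictlyDominates (SimpleGraph.cycleGraph m)
      (LaplacianOrder.addIsolated G (m - n)) := by
  classical
  obtain ⟨hn, hm⟩ := hsize
  obtain ⟨hnt, h2⟩ := hconn
  have hdel : ∀ e, (G.deleteEdges {e}).Connected := fun e =>
    ⟨isEdgeConnected_two.1 h2 e⟩
  have hG : G.Connected := h2.connected (by norm_num)
  have hnm : n < m := by
    by_contra hle
    exact hcyc (exists_iso_cycleGraph hG hdel (by omega))
  obtain ⟨a, b, hab⟩ : ∃ a b, G.Adj a b := by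
    obtain ⟨v⟩ := hG.nonempty
    exact ⟨v, hG.preconnected.exists_adj_of_nontrivial v⟩
  have hn3 : 2 < n := by
    rw [← hn]
    exact lt_of_le_of_lt (h2.le_degree (u := a)) (G.degree_lt_card_verts a)
  obtain ⟨M, rfl⟩ : ∃ M, m = M + 1 := ⟨m - 1, by omega⟩
  set H := addIsolated G (M + 1 - n) with hH
  have hHE : H.edgeSet = Sym2.map Sum.inl '' G.edgeSet := edgeSet_sum_bot
  have hcardV : Fintype.card (V ⊕ Fin (M + 1 - n)) = M + 1 := by
    rw [Fintype.card_sum, hn, Fintype.card_fin]; omega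
  have hcardH : H.edgeSet.ncard = M + 1 := by
    rw [hHE, Set.ncard_image_of_injective _ (Sym2.map.injective Sum.inl_injective), hm]
  have hcardC : (cycleGraph (M + 1)).edgeSet.ncard = M + 1 := by
    rw [← coe_cycleEdges (by omega), Set.ncard_coe_finset, card_cycleEdges (by omega)]
  set r : V ⊕ Fin (M + 1 - n) := Sum.inl a
  set u : V ⊕ Fin (M + 1 - n) := Sum.inl b
  set z : V ⊕ Fin (M + 1 - n) := Sum.inr ⟨0, by omega⟩
  have hru : r ≠ u := fun h => hab.ne (Sum.inl_injective h)
  have hEu : s(r, u) ∈ H.edgeFinset := by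
    rw [mem_edgeFinset, hHE]
    exact ⟨s(a, b), hab, rfl⟩
  set E := H.edgeFinset.erase s(r, u) with hE
  have hEH : (insert s(r, u) E : Finset _) = H.edgeFinset := Finset.insert_erase hEu
  have hEcard : E.card = M := by
    rw [hE, Finset.card_erase_of_mem hEu, ← Set.ncard_coe_finset, coe_edgeFinset, hcardH]
    rfl
  have hmemE : ∀ e ∈ E, ∃ e' ∈ (G.deleteEdges {s(a, b)}).edgeSet, Sym2.map Sum.inl e' = e := by
    intro e he
    obtain ⟨hne, he⟩ := Finset.mem_erase.1 he
    rw [mem_edgeFinset, hHE] at he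
    obtain ⟨e', he', rfl⟩ := he
    refine ⟨e', ?_, rfl⟩
    rw [edgeSet_deleteEdges]
    exact ⟨he', fun h => hne (by rw [Set.mem_singleton_iff.1 h]; rfl)⟩
  have hinl : ∀ v w : V, (fromEdgeSet (E : Set (Sym2 (V ⊕ Fin (M + 1 - n))))).Reachable
      (Sum.inl v) (Sum.inl w) := by
    intro v w
    let φ : G.deleteEdges {s(a, b)} →g
        fromEdgeSet (E : Set (Sym2 (V ⊕ Fin (M + 1 - n)))) :=
      { toFun := Sum.inl
        map_rel' := by
          intro x y hxy
          rw [deleteEdges_adj] at hxy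
          rw [fromEdgeSet_adj]
          refine ⟨Finset.mem_coe.2 (Finset.mem_erase.2 ⟨fun h => hxy.2 ?_, ?_⟩), fun h =>
            hxy.1.ne (Sum.inl_injective h)⟩
          · exact Sym2.map.injective Sum.inl_injective h
          · rw [mem_edgeFinset, hHE]
            exact ⟨s(x, y), hxy.1, rfl⟩ }
    exact ((hdel s(a, b)).preconnected v w).map φ
  have hreach : ∀ v : V, EdgesReachable E (Sum.inl v) := by
    intro v e he w hw
    obtain ⟨e', -, rfl⟩ := hmemE e he
    obtain ⟨w', -, rfl⟩ := Sym2.mem_map.1 hw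
    exact hinl v w'
  have hz : ∀ e ∈ E, z ∉ e := by
    intro e he hze
    obtain ⟨e', -, rfl⟩ := hmemE e he
    obtain ⟨w', -, h⟩ := Sym2.mem_map.1 hze
    exact absurd h (by simp [z])
  -- The degree `k = M + 1 - s` runs through `1, …, M - 1`, exactly where the gap has positive
  -- coefficients. As there are as many vertices as edges, this range serves both cases of the
  -- relation.
  have key : ∀ s, 2 ≤ s → s < M + 1 → lapCoeff H s < lapCoeff (cycleGraph (M + 1)) s := by
    intro s hs hsM
    rw [lapCoeff_eq_coeff_lapDet H (E := insert s(r, u) E) (by rw [hEH, coe_edgeFinset])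
        (by omega), lapCoeff_eq_coeff_lapDet _ (coe_cycleEdges (by omega)) (by simpa using hsM),
      lapDet_cycleEdges (by omega), hcardV, Fintype.card_fin]
    have h := lapDet_insert_lt_cycle (E := E) hru (by simp [r, z]) (Finset.notMem_erase _ _)
      (fun e he => H.not_isDiag_of_mem_edgeFinset (Finset.mem_of_mem_erase he))
      (hreach a) (hreach b) hz (by omega) (k := M + 1 - s) (by omega) (by omega)
    rwa [hEcard] at h
  exact ⟨M + 1, M + 1, ⟨Fintype.card_fin _, hcardC⟩, ⟨hcardV, hcardH⟩, fun _ => key, fun _ => key⟩
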